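/- Fix constants $0<\eta<\widetilde\eta$ (energy efficiency before/after a retrofit), $K>0$ (retrofit cost), $\rho\ge\mu_R>0$ (borrowing and risk-free rates), $P>0$ (energy price), $Y>0$ (labour income), $\mu_S>\mu_R$, $\sigma_S>0$ (index fund), $\delta,\lambda>0$, $\underline x,\underline s>0$, $\beta\in(0,1)$, $\gamma>1$, $\epsilon,\mu_\varpi,\sigma_\varpi>0$, and put $\widehat\delta=\delta+\lambda$, $\widehat\epsilon=\epsilon+\lambda$, $$H=\tfrac1{\mu_R}\Big(Y-\underline x-\tfrac{\underline s}{\eta}P\Big),\qquad \widetilde H=\tfrac1{\mu_R}\Big(Y-\rho K-\underline x-\tfrac{\underline s}{\widetilde\eta}P\Big),\qquad U(x,s)=\frac{\big((x-\underline x)^{1-\beta}(s-\underline s)^{\beta}\big)^{1-\gamma}}{1-\gamma}$$ for $x>\underline x$, $s>\underline s$, and $U=-\infty$ otherwise. Let $B$ be a standard Brownian motion relative to a filtration on a probability space. A plan from initial wealth $w$ consists of a stopping time $\tau\in[0,\infty]$ (the time of the retrofit), progressive controls $a$ (share of wealth in the index fund) and $x,s\ge0$ (consumption rates of the non-energy good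 and of the energy service), and a continuous progressive wealth process with $W_0=w$ and $$dW_t=\big(a_t\mu_SW_t+(1-a_t)\mu_RW_t+Y-x_t\big)dt+a_t\sigma_SW_t\,dB_t-\Big(\tfrac{s_t}{\eta}P\,\mathbf 1_{\{t<\tau\}}+\big(\tfrac{s_t}{\widetilde\eta}P+\rho K\big)\mathbf 1_{\{t\ge\tau\}}\Big)dt .$$ It is admissible if, almost surely, $W_t+H>0$ for all $t<\tau$ and $W_t+\widetilde H>0$ for all $t\ge\tau$. Let $$F(w)=\sup_{a,x,s,\tau}\mathbb E\int_0^\infty e^{-\widehat\delta t}U(x_t,s_t)\,dt$$ over all admissible plans from $w$, and let $\widehat F(w)$ be the same supremum over the plans with $\tau=\infty$ (the counterfactual). The equivalent variation is $V_{\mathrm{ev}}(w)=\widehat F^{-1}(F(w))-w$, where $\widehat F^{-1}$ is the inverse of $\widehat F$ on $(-H,\infty)$. Let $w>-H$ and $\pi>0$. Then there is exactly one $w'>-H$ with $\widehat F(w')=F(w)$, so that $V_{\mathrm{ev}}(w)$ is well defined, and $V_{\mathrm{ev}}(w)\ge0$. Moreover, let $(a^*,x^*,s^*,\tau^*)$ be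 optimal for $F(w)$ and $(\widehat a^*,\widehat x^*,\widehat s^*)$ optimal for $\widehat F(w)$, and let the marginal social cost $\varpi$ be a geometric Brownian motion with drift $\mu_\varpi$, volatility $\sigma_\varpi$ and $\varpi_0=\pi$, independent of the corresponding wealth processes. Put $$Q_t=\begin{cases}s^*_t/\eta-\widehat s^*_t/\eta,&t<\tau^*,\\ s^*_t/\widetilde\eta-\widehat s^*_t/\eta,&t\ge\tau^*,\end{cases}\qquad V_{\mathrm{sc}}=\mathbb E\int_0^\infty e^{-\widehat\epsilon t}\varpi_tQ_t\,dt,\qquad V=V_{\mathrm{ev}}(w)-V_{\mathrm{sc}} .$$ If there is no backfire, i.e. $Q_t\le0$ almost surely for every $t\ge0$, then $V_{\mathrm{sc}}\le0$ (possibly $-\infty$), and the retrofit option (weakly) improves total welfare: $V\ge0$ (possibly $+\infty$). -/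

import Mathlib

open MeasureTheory ProbabilityTheory Filter Topology
open scoped NNReal ENNReal

namespace Retrofit

noncomputable section

/-- Parameters of the model together with their standing sign and order conditions. -/
structure Model where
  /-- efficiency before the retrofit -/
  η : ℝ
  /-- efficiency after the retrofit -/
  ηR : ℝ
  /-- retrofit cost -/
  K : ℝ
  /-- borrowing rate -/
  ρ : ℝ
  /-- energy price -/
  price : ℝ
  /-- labour income rate -/
  Y : ℝ
  /-- risk-free rate -/
  μR : ℝ
  /-- drift of the index fund -/
  μS : ℝ
  /-- volatility of the index fund -/
  σS : ℝ
  /-- rate of time preference -/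
  δ : ℝ
  /-- hazard rate of the random horizon -/
  hazard : ℝ
  /-- subsistence level of the non-energy good -/
  xSub : ℝ
  /-- subsistence level of the energy service -/
  sSub : ℝ
  /-- preference weight on the energy service -/
  β : ℝ
  /-- coefficient of risk aversion -/
  γ : ℝ
  /-- social discount rate -/
  ε : ℝ
  /-- drift of the marginal social cost -/
  μϖ : ℝ
  /-- volatility of the marginal social cost -/
  σϖ : ℝ
  η_pos : 0 < η
  η_lt : η < ηR
  K_pos : 0 < K
  μR_pos : 0 < μR
  μR_le : μR ≤ ρ
  price_pos : 0 < price
  Y_pos : 0 < Y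
  μS_gt : μR < μS
  σS_pos : 0 < σS
  δ_pos : 0 < δ
  hazard_pos : 0 < hazard
  xSub_pos : 0 < xSub
  sSub_pos : 0 < sSub
  β_pos : 0 < β
  β_lt : β < 1
  γ_gt : 1 < γ
  ε_pos : 0 < ε
  μϖ_pos : 0 < μϖ
  σϖ_pos : 0 < σϖ

namespace Model

/-- Effective discount rate of the agent. -/
def δHat (m : Model) : ℝ := m.δ + m.hazard

/-- Effective social discount rate. -/
def εHat (m : Model) : ℝ := m.ε + m.hazard

/-- Human capital (net of subsistence consumption) without the retrofit. -/
def H (m : Model) : ℝ := (m.Y - m.xSub - m.sSub / m.η * m.price) / m.μR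

/-- Human capital (net of subsistence consumption) with the retrofit: labour income is reduced
by the loan payment `ρ K` and the energy service is obtained at the higher efficiency. -/
def HR (m : Model) : ℝ := (m.Y - m.ρ * m.K - m.xSub - m.sSub / m.ηR * m.price) / m.μR

/-- Stone-Geary utility; it is `-∞` unless both goods are consumed above subsistence. -/
def utility (m : Model) (x s : ℝ) : EReal :=
  if m.xSub < x ∧ m.sSub < s then
    ((((x - m.xSub) ^ (1 - m.β) * (s - m.sSub) ^ m.β) ^ (1 - m.γ) / (1 - m.γ) : ℝ) : EReal)
  else ⊥

end Model

/-- Lebesgue measure on the time axis `[0, ∞)`. -/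
def timeMeasure : Measure ℝ≥0 := (volume : Measure ℝ).comap (fun t : ℝ≥0 => (t : ℝ))

variable {Ω : Type*} {mΩ : MeasurableSpace Ω}

/-- `B` is a standard Brownian motion relative to the filtration `𝓕`. -/
structure IsBrownianFor (𝓕 : Filtration ℝ≥0 mΩ) (P : Measure Ω) (B : ℝ≥0 → Ω → ℝ) : Prop where
  brownian : IsBrownianReal B P
  adapted : StronglyAdapted 𝓕 B
  indep : ∀ r t : ℝ≥0, r ≤ t →
    Indep (MeasurableSpace.comap (fun ω => B t ω - B r ω) inferInstance) (𝓕 r) P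

/-- Bounded simple predictable processes `∑ i < n, ξ i * 1_{(t i, t (i + 1)]}`. -/
structure SimpleIntegrand (𝓕 : Filtration ℝ≥0 mΩ) where
  n : ℕ
  time : ℕ → ℝ≥0
  ξ : ℕ → Ω → ℝ
  time_mono : Monotone time
  meas : ∀ i, StronglyMeasurable[𝓕 (time i)] (ξ i)
  bdd : ∀ i, ∃ C : ℝ, ∀ ω, |ξ i ω| ≤ C

namespace SimpleIntegrand

variable {𝓕 : Filtration ℝ≥0 mΩ}

/-- The simple process itself. -/
def process (V : SimpleIntegrand 𝓕) (t : ℝ≥0) (ω : Ω) : ℝ :=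
  ∑ i ∈ Finset.range V.n, (Set.Ioc (V.time i) (V.time (i + 1))).indicator (fun _ => V.ξ i ω) t

/-- The elementary stochastic integral up to time `t`. -/
def integral (V : SimpleIntegrand 𝓕) (B : ℝ≥0 → Ω → ℝ) (t : ℝ≥0) (ω : Ω) : ℝ :=
  ∑ i ∈ Finset.range V.n, V.ξ i ω * (B (min (V.time (i + 1)) t) ω - B (min (V.time i) t) ω)

end SimpleIntegrand

/-- `M` is (a continuous version of) the Itô integral process `∫₀ᵗ A dB`: there are bounded simple
processes `V k` such that, for every horizon `T`, `∫₀ᵀ (V k - A)² dt → 0` in probability and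
`∫ V k dB → M` uniformly on `[0, T]` in probability. Such `V k` exist exactly when
`∫₀ᵀ A² dt < ∞` almost surely for all `T`. -/
structure IsItoIntegral (𝓕 : Filtration ℝ≥0 mΩ) (P : Measure Ω) (B A M : ℝ≥0 → Ω → ℝ) :
    Prop where
  integrand_prog : IsStronglyProgressive 𝓕 A
  cont : ∀ᵐ ω ∂P, Continuous (fun t => M t ω)
  approx : ∃ V : ℕ → SimpleIntegrand 𝓕, ∀ T : ℝ≥0,
    (∀ c : ℝ≥0∞, 0 < c → Tendsto (fun k => P {ω | c ≤ ∫⁻ t in Set.Iic T,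
      ENNReal.ofReal (((V k).process t ω - A t ω) ^ 2) ∂timeMeasure}) atTop (𝓝 0)) ∧
    (∀ c : ℝ, 0 < c → Tendsto (fun k => P {ω | ∃ t ≤ T,
      c ≤ |(V k).integral B t ω - M t ω|}) atTop (𝓝 0))

/-- The controls: share `a` of wealth held in the index fund, consumption rate `x` of the
non-energy good, consumption rate `s` of the energy service. -/
structure Controls (Ω : Type*) where
  a : ℝ≥0 → Ω → ℝ
  x : ℝ≥0 → Ω → ℝ
  s : ℝ≥0 → Ω → ℝ

open Classical in
/-- Drift of wealth when the retrofit takes place at time `τ`. -/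
def wealthDrift (m : Model) (τ : Ω → WithTop ℝ≥0) (u : Controls Ω) (W : ℝ≥0 → Ω → ℝ)
    (t : ℝ≥0) (ω : Ω) : ℝ :=
  u.a t ω * m.μS * W t ω + (1 - u.a t ω) * m.μR * W t ω + (m.Y - u.x t ω)
    - (if (t : WithTop ℝ≥0) < τ ω then u.s t ω / m.η * m.price
        else u.s t ω / m.ηR * m.price + m.ρ * m.K)

/-- `W` solves the wealth equation
`dW = drift dt + a σ_S W dB`, `W₀ = w`, for the retrofit time `τ`. -/
structure IsWealth (𝓕 : Filtration ℝ≥0 mΩ) (P : Measure Ω) (B : ℝ≥0 → Ω → ℝ) (m : Model)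
    (w : ℝ) (τ : Ω → WithTop ℝ≥0) (u : Controls Ω) (W : ℝ≥0 → Ω → ℝ) : Prop where
  prog : IsStronglyProgressive 𝓕 W
  cont : ∀ᵐ ω ∂P, Continuous (fun t => W t ω)
  drift_integrable : ∀ᵐ ω ∂P, ∀ t : ℝ≥0,
    IntegrableOn (fun r => wealthDrift m τ u W r ω) (Set.Iic t) timeMeasure
  eqn : ∃ M : ℝ≥0 → Ω → ℝ,
    IsItoIntegral 𝓕 P B (fun t ω => u.a t ω * m.σS * W t ω) M ∧
    ∀ᵐ ω ∂P, ∀ t : ℝ≥0,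
      W t ω = w + (∫ r in Set.Iic t, wealthDrift m τ u W r ω ∂timeMeasure) + M t ω

open Classical in
/-- Admissible plans from initial wealth `w`: a stopping time `τ` with values in `[0, ∞]`,
progressive controls, and a wealth process for which disposable capital (wealth plus the human
capital of the current regime) stays positive. -/
structure IsAdmissible (𝓕 : Filtration ℝ≥0 mΩ) (P : Measure Ω) (B : ℝ≥0 → Ω → ℝ) (m : Model)
    (w : ℝ) (τ : Ω → WithTop ℝ≥0) (u : Controls Ω) (W : ℝ≥0 → Ω → ℝ) : Prop where
  stopping : IsStoppingTime 𝓕 τ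
  a_prog : IsStronglyProgressive 𝓕 u.a
  x_prog : IsStronglyProgressive 𝓕 u.x
  s_prog : IsStronglyProgressive 𝓕 u.s
  x_nonneg : ∀ t ω, 0 ≤ u.x t ω
  s_nonneg : ∀ t ω, 0 ≤ u.s t ω
  wealth : IsWealth 𝓕 P B m w τ u W
  capital_pos : ∀ᵐ ω ∂P, ∀ t : ℝ≥0,
    0 < W t ω + (if (t : WithTop ℝ≥0) < τ ω then m.H else m.HR)

/-- The no-investment limit `τ = ∞`. -/
def never : Ω → WithTop ℝ≥0 := fun _ => ⊤

/-- Expected discounted utility `𝔼 ∫₀^∞ e^{-δ̂ t} U(x_t, s_t) dt`, an element of `[-∞, 0]`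
because `U < 0` for risk aversion larger than one. -/
def expectedUtility (P : Measure Ω) (m : Model) (u : Controls Ω) : EReal :=
  -((∫⁻ ω, ∫⁻ t, ENNReal.ofReal (Real.exp (-m.δHat * t)) *
    (-m.utility (u.x t ω) (u.s t ω)).toENNReal ∂timeMeasure ∂P : ℝ≥0∞) : EReal)

/-- The value function `F(w)`. -/
def valueF (𝓕 : Filtration ℝ≥0 mΩ) (P : Measure Ω) (B : ℝ≥0 → Ω → ℝ) (m : Model)
    (w : ℝ) : EReal :=
  ⨆ (τ : Ω → WithTop ℝ≥0) (u : Controls Ω) (W : ℝ≥0 → Ω → ℝ)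
    (_ : IsAdmissible 𝓕 P B m w τ u W), expectedUtility P m u

/-- The counterfactual value function `F̂(w)`. -/
def valueFHat (𝓕 : Filtration ℝ≥0 mΩ) (P : Measure Ω) (B : ℝ≥0 → Ω → ℝ) (m : Model)
    (w : ℝ) : EReal :=
  ⨆ (u : Controls Ω) (W : ℝ≥0 → Ω → ℝ)
    (_ : IsAdmissible 𝓕 P B m w never u W), expectedUtility P m u

/-- `(a, x, s, τ)` with wealth `W` is optimal in the agent's problem. -/
def IsOptimal (𝓕 : Filtration ℝ≥0 mΩ) (P : Measure Ω) (B : ℝ≥0 → Ω → ℝ) (m : Model)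
    (w : ℝ) (τ : Ω → WithTop ℝ≥0) (u : Controls Ω) (W : ℝ≥0 → Ω → ℝ) : Prop :=
  IsAdmissible 𝓕 P B m w τ u W ∧ expectedUtility P m u = valueF 𝓕 P B m w

/-- `(â, x̂, ŝ)` with wealth `W` is optimal in the counterfactual problem. -/
def IsOptimalHat (𝓕 : Filtration ℝ≥0 mΩ) (P : Measure Ω) (B : ℝ≥0 → Ω → ℝ) (m : Model)
    (w : ℝ) (u : Controls Ω) (W : ℝ≥0 → Ω → ℝ) : Prop :=
  IsAdmissible 𝓕 P B m w never u W ∧ expectedUtility P m u = valueFHat 𝓕 P B m w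

/-- The expenditure function `F̂⁻¹`, the inverse of `F̂` on its domain `(-H, ∞)`. -/
def expenditure (𝓕 : Filtration ℝ≥0 mΩ) (P : Measure Ω) (B : ℝ≥0 → Ω → ℝ) (m : Model)
    (v : EReal) : ℝ :=
  Function.invFunOn (valueFHat 𝓕 P B m) (Set.Ioi (-m.H)) v

/-- The equivalent variation `V_ev(w) = F̂⁻¹(F(w)) - w`. -/
def equivalentVariation (𝓕 : Filtration ℝ≥0 mΩ) (P : Measure Ω) (B : ℝ≥0 → Ω → ℝ) (m : Model)
    (w : ℝ) : ℝ :=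
  expenditure 𝓕 P B m (valueF 𝓕 P B m w) - w

open Classical in
/-- The backfire measure `Q_t`, for retrofit time `τ`, energy service `s` and counterfactual
energy service `sHat`. -/
def backfire (m : Model) (τ : Ω → WithTop ℝ≥0) (s sHat : ℝ≥0 → Ω → ℝ) (t : ℝ≥0) (ω : Ω) : ℝ :=
  if (t : WithTop ℝ≥0) < τ ω then s t ω / m.η - sHat t ω / m.η
  else s t ω / m.ηR - sHat t ω / m.η

/-- The marginal social cost of energy consumption: the geometric Brownian motion with drift
`μϖ`, volatility `σϖ` and initial value `p`, driven by the Brownian motion `Bϖ`. -/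
def marginalSocialCost (m : Model) (p : ℝ) (Bϖ : ℝ≥0 → Ω → ℝ) (t : ℝ≥0) (ω : Ω) : ℝ :=
  p * Real.exp ((m.μϖ - m.σϖ ^ 2 / 2) * t + m.σϖ * Bϖ t ω)

/-- The change in social cost `V_sc = 𝔼 ∫₀^∞ e^{-ε̂ t} ϖ_t Q_t dt`, as an extended real: the
integral of the positive part minus the integral of the negative part. -/
def socialCost (P : Measure Ω) (m : Model) (p : ℝ) (Bϖ : ℝ≥0 → Ω → ℝ)
    (τ : Ω → WithTop ℝ≥0) (s sHat : ℝ≥0 → Ω → ℝ) : EReal :=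
  ((∫⁻ ω, ∫⁻ t, ENNReal.ofReal (Real.exp (-m.εHat * t) * marginalSocialCost m p Bϖ t ω *
      backfire m τ s sHat t ω) ∂timeMeasure ∂P : ℝ≥0∞) : EReal) -
  ((∫⁻ ω, ∫⁻ t, ENNReal.ofReal (-(Real.exp (-m.εHat * t) * marginalSocialCost m p Bϖ t ω *
      backfire m τ s sHat t ω)) ∂timeMeasure ∂P : ℝ≥0∞) : EReal)

/-- The total welfare change `V = V_ev - V_sc`. -/
def totalWelfare (𝓕 : Filtration ℝ≥0 mΩ) (P : Measure Ω) (B : ℝ≥0 → Ω → ℝ) (m : Model)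
    (w p : ℝ) (Bϖ : ℝ≥0 → Ω → ℝ) (τ : Ω → WithTop ℝ≥0) (s sHat : ℝ≥0 → Ω → ℝ) : EReal :=
  (equivalentVariation 𝓕 P B m w : EReal) - socialCost P m p Bϖ τ s sHat

end

end Retrofit

namespace Retrofit

/-! ### Lebesgue measure on the half-line of times -/

section TimeMeasure

/-! Since γ > 1, utility is negative, and both problems amount to minimising an expected disutility
in [0, ∞] (`lossF`, `lossFHat`). Never retrofitting is one of the available plans, so `lossF ≤
lossFHat`. What remains for the equivalent variation are three facts: `lossFHat` is finite on (-H,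
∞), it is proportional there to (w + H)^(1-γ), and `lossF` is positive. Then F̂ maps (-H, ∞)
strictly increasingly onto (-∞, 0), and F(w) lies in [F̂(w), 0). So the equation has exactly one
solution, and it is at least w.

Finiteness comes from an explicit risk-free plan (`isAdmissible_constant`). Proportionality
(`lossFHat_eq`) comes from scaling disposable capital W + H and consumption above subsistence by a
factor k, which multiplies disutility by k^(1-γ). The scaled share in the fund is k a W / W', which
is meaningless where the new wealth W' vanishes. A small extra capital D e^(-ct), with c chosen to
avoid this for almost all times and states (`exists_rate_avoiding`), repairs it. The cost disappears
in the limit of k.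

Positivity (`lossF_pos`) is the hard part, because it needs a bound uniform over all plans, whatever
their leverage. Under the measure that absorbs the risk premium into the Brownian motion, discounted
gains are limits of martingales. Positive capital keeps them above a level -b, so they exceed a
large a with probability of order b/a. Hence spending on [0, 1] is bounded in probability uniformly
in the plan (`driftRemovingMeasure_consumption_le`). Equivalence of the measures carries this back
to P, and bounded spending forces a definite amount of disutility. The supermartingale argument is
made on a time grid with elementary integrals (`measure_stays_above_and_reaches_le`), where fourth
moments make the overshoot at the stopping time negligible beyond a constant.

The social cost is a sign question: ϖ is positive and Q is nonpositive almost everywhere, so the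
positive part of the integrand contributes nothing. -/

lemma measurableEmbedding_nnreal_coe : MeasurableEmbedding (fun t : ℝ≥0 => (t : ℝ)) :=
  MeasurableEmbedding.subtype_coe measurableSet_Ici

lemma timeMeasure_apply (s : Set ℝ≥0) :
    timeMeasure s = volume ((fun t : ℝ≥0 => (t : ℝ)) '' s) :=
  measurableEmbedding_nnreal_coe.comap_apply _ _

lemma map_timeMeasure :
    timeMeasure.map (fun t : ℝ≥0 => (t : ℝ)) = (volume : Measure ℝ).restrict (Set.Ici 0) := by
  rw [timeMeasure, measurableEmbedding_nnreal_coe.map_comap]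
  congr 1
  ext x
  simp only [Set.mem_range, Set.mem_Ici]
  exact ⟨fun ⟨y, hy⟩ => hy ▸ y.2, fun h => ⟨⟨x, h⟩, rfl⟩⟩

instance : SigmaFinite timeMeasure :=
  SigmaFinite.of_map _ measurableEmbedding_nnreal_coe.measurable.aemeasurable
    (by rw [map_timeMeasure]; infer_instance)

instance : NullSingletonClass timeMeasure where
  measure_singleton x := by rw [timeMeasure_apply]; simp

lemma image_coe_Ioc (a b : ℝ≥0) :
    (fun t : ℝ≥0 => (t : ℝ)) '' Set.Ioc a b = Set.Ioc (a : ℝ) b := by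
  ext x
  constructor
  · rintro ⟨y, hy, rfl⟩
    exact ⟨by exact_mod_cast hy.1, by exact_mod_cast hy.2⟩
  · rintro ⟨h1, h2⟩
    exact ⟨⟨x, a.2.trans h1.le⟩, ⟨h1, h2⟩, rfl⟩

lemma timeMeasure_Ioc (a b : ℝ≥0) : timeMeasure (Set.Ioc a b) = ENNReal.ofReal (b - a) := by
  rw [timeMeasure_apply, image_coe_Ioc, Real.volume_Ioc]

lemma timeMeasure_Iic (t : ℝ≥0) : timeMeasure (Set.Iic t) = t := by
  have : Set.Iic t = insert 0 (Set.Ioc 0 t) := by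
    ext x
    simp only [Set.mem_Iic, Set.mem_insert_iff, Set.mem_Ioc]
    constructor
    · intro h
      rcases eq_or_ne x 0 with h0 | h0
      · exact Or.inl h0
      · exact Or.inr ⟨pos_iff_ne_zero.2 h0, h⟩
    · rintro (rfl | h)
      · exact zero_le
      · exact h.2
  have h2 : timeMeasure (Set.Iic t) = timeMeasure (Set.Ioc 0 t) := by
    rw [this]
    exact measure_congr (insert_ae_eq_self 0 _)
  rw [h2, timeMeasure_Ioc]
  simp

instance (t : ℝ≥0) : IsFiniteMeasure (timeMeasure.restrict (Set.Iic t)) :=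
  ⟨by rw [Measure.restrict_apply_univ, timeMeasure_Iic]; exact ENNReal.coe_lt_top⟩

lemma setIntegral_Ioc_timeMeasure (f : ℝ → ℝ) {a b : ℝ≥0} (hab : a ≤ b) :
    ∫ r in Set.Ioc a b, f r ∂timeMeasure = ∫ r in (a : ℝ)..b, f r := by
  rw [intervalIntegral.integral_of_le (by exact_mod_cast hab), ← image_coe_Ioc]
  have := measurableEmbedding_nnreal_coe.setIntegral_map (μ := timeMeasure) f
    ((fun t : ℝ≥0 => (t : ℝ)) '' Set.Ioc a b)
  rw [map_timeMeasure, Set.preimage_image_eq _ NNReal.coe_injective,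
    Measure.restrict_restrict] at this
  · rw [← this]
    congr 2
    refine Set.inter_eq_left.2 ?_
    rintro _ ⟨y, -, rfl⟩
    exact y.2
  · rw [image_coe_Ioc]; exact measurableSet_Ioc

lemma Iic_ae_eq_Ioc (t : ℝ≥0) : (Set.Ioc 0 t : Set ℝ≥0) =ᵐ[timeMeasure] Set.Iic t := by
  have h : ({0}ᶜ : Set ℝ≥0) ∈ ae timeMeasure := by
    rw [mem_ae_iff, compl_compl]; exact measure_singleton 0
  filter_upwards [h] with x hx
  have : (0 : ℝ≥0) < x := pos_iff_ne_zero.2 hx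
  apply propext
  change (x ∈ Set.Ioc 0 t) ↔ (x ∈ Set.Iic t)
  simp [this]

lemma setIntegral_Iic_timeMeasure (f : ℝ → ℝ) (t : ℝ≥0) :
    ∫ r in Set.Iic t, f r ∂timeMeasure = ∫ r in (0 : ℝ)..t, f r := by
  rw [← setIntegral_congr_set (Iic_ae_eq_Ioc t), setIntegral_Ioc_timeMeasure f zero_le]
  simp

lemma setIntegral_Iic_sub (f : ℝ≥0 → ℝ) {a b : ℝ≥0} (hab : a ≤ b)
    (hf : IntegrableOn f (Set.Iic b) timeMeasure) :
    ∫ r in Set.Iic b, f r ∂timeMeasure - ∫ r in Set.Iic a, f r ∂timeMeasure =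
      ∫ r in Set.Ioc a b, f r ∂timeMeasure := by
  have : Set.Iic b = Set.Iic a ∪ Set.Ioc a b := (Set.Iic_union_Ioc_eq_Iic hab).symm
  rw [this, setIntegral_union (Set.Iic_disjoint_Ioc le_rfl) measurableSet_Ioc
    (hf.mono_set (Set.Iic_subset_Iic.2 hab)) (hf.mono_set Set.Ioc_subset_Iic_self)]
  ring

lemma setIntegral_const_Ioc {a b : ℝ≥0} (hab : a ≤ b) (c : ℝ) :
    ∫ _ in Set.Ioc a b, c ∂timeMeasure = ((b : ℝ) - a) * c := by
  rw [setIntegral_const, measureReal_def, timeMeasure_Ioc, ENNReal.toReal_ofReal]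
  · rfl
  · exact sub_nonneg.2 (by exact_mod_cast hab)

lemma continuous_integrableOn_Iic {f : ℝ≥0 → ℝ} (hf : Continuous f) (t : ℝ≥0) :
    IntegrableOn f (Set.Iic t) timeMeasure := by
  obtain ⟨C, hC⟩ := (isCompact_Icc (a := (0 : ℝ≥0)) (b := t)).exists_bound_of_continuousOn
    hf.continuousOn
  refine Integrable.mono' (integrable_const C) hf.aestronglyMeasurable ?_
  filter_upwards [ae_restrict_mem measurableSet_Iic] with x hx
  exact hC x ⟨zero_le, hx⟩

end TimeMeasure

/-! ### Joint measurability of progressive processes -/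

section Measurability

variable {Ω : Type*} {mΩ : MeasurableSpace Ω} {𝓕 : Filtration ℝ≥0 mΩ}

/-- A progressive process is jointly measurable. -/
lemma measurable_uncurry_of_prog {X : ℝ≥0 → Ω → ℝ} (h : IsStronglyProgressive 𝓕 X) :
    Measurable (fun p : ℝ≥0 × Ω => X p.1 p.2) := by
  -- Capping time at n brings the argument into [0, n], where progressive measurability applies;
  -- each point is eventually unaffected by the cap.
  have key : ∀ n : ℕ, Measurable (fun p : ℝ≥0 × Ω => X (min p.1 n) p.2) := by
    intro n
    have h1 : @Measurable (Set.Iic (n : ℝ≥0) × Ω) ℝ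
        (@Prod.instMeasurableSpace _ _ _ mΩ) _ (fun p => X (p.1 : ℝ≥0) p.2) := by
      refine (h n).measurable.mono ?_ le_rfl
      exact sup_le_sup le_rfl (MeasurableSpace.comap_mono (𝓕.le n))
    have h2 : Measurable (fun p : ℝ≥0 × Ω =>
        ((⟨min p.1 n, Set.mem_Iic.2 (min_le_right _ _)⟩ : Set.Iic (n : ℝ≥0)), p.2)) := by
      refine Measurable.prodMk (Measurable.subtype_mk ?_) measurable_snd
      exact measurable_fst.min measurable_const
    exact h1.comp h2
  refine measurable_of_tendsto_metrizable key ?_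
  rw [tendsto_pi_nhds]
  intro p
  obtain ⟨N, hN⟩ := exists_nat_ge p.1
  refine tendsto_const_nhds.congr' ?_
  filter_upwards [eventually_ge_atTop N] with n hn
  rw [min_eq_left (hN.trans (by exact_mod_cast hn))]

lemma measurable_section_of_prog {X : ℝ≥0 → Ω → ℝ} (h : IsStronglyProgressive 𝓕 X) (ω : Ω) :
    Measurable (fun t => X t ω) :=
  (measurable_uncurry_of_prog h).comp (measurable_id.prodMk measurable_const)

lemma measurableSet_lt_stopping {τ : Ω → WithTop ℝ≥0} (hτ : IsStoppingTime 𝓕 τ) :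
    MeasurableSet {p : ℝ≥0 × Ω | ((p.1 : ℝ≥0) : WithTop ℝ≥0) < τ p.2} := by
  have : Measurable τ := hτ.measurable'
  exact measurableSet_lt (measurable_fst.withTop_coe) (this.comp measurable_snd)

end Measurability

/-! ### The sign of the social cost -/

section SocialCost

variable {Ω : Type*} {mΩ : MeasurableSpace Ω} {𝓕 : Filtration ℝ≥0 mΩ} {P : Measure Ω}
  {m : Model}

lemma measurable_backfire {τ : Ω → WithTop ℝ≥0} (hτ : IsStoppingTime 𝓕 τ)
    {s sHat : ℝ≥0 → Ω → ℝ} (hs : IsStronglyProgressive 𝓕 s)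
    (hsHat : IsStronglyProgressive 𝓕 sHat) :
    Measurable (fun q : ℝ≥0 × Ω => backfire m τ s sHat q.1 q.2) := by
  have h1 := measurable_uncurry_of_prog hs
  have h2 := measurable_uncurry_of_prog hsHat
  exact Measurable.ite (measurableSet_lt_stopping hτ) ((h1.div_const _).sub (h2.div_const _))
    ((h1.div_const _).sub (h2.div_const _))

/-- The exceptional null set of states may depend on t; Fubini exchanges the two quantifiers, which
is why joint measurability is needed. -/
lemma ae_ae_nonpos [SFinite P] {Q : ℝ≥0 → Ω → ℝ} (hQ : Measurable (fun q : ℝ≥0 × Ω => Q q.1 q.2))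
    (h : ∀ t : ℝ≥0, ∀ᵐ ω ∂P, Q t ω ≤ 0) : ∀ᵐ ω ∂P, ∀ᵐ t ∂timeMeasure, Q t ω ≤ 0 := by
  refine Measure.ae_ae_comm (μ := timeMeasure) (ν := P) (p := fun t ω => Q t ω ≤ 0) ?_ |>.1
    (ae_of_all _ h)
  exact measurableSet_le hQ measurable_const

lemma socialCost_pos_part_eq_zero {p : ℝ} (hp : 0 < p) {Bϖ : ℝ≥0 → Ω → ℝ}
    {τ : Ω → WithTop ℝ≥0} {s sHat : ℝ≥0 → Ω → ℝ}
    (h : ∀ᵐ ω ∂P, ∀ᵐ t ∂timeMeasure, backfire m τ s sHat t ω ≤ 0) :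
    ∫⁻ ω, ∫⁻ t, ENNReal.ofReal (Real.exp (-m.εHat * t) * marginalSocialCost m p Bϖ t ω *
      backfire m τ s sHat t ω) ∂timeMeasure ∂P = 0 := by
  rw [← lintegral_zero (μ := P)]
  refine lintegral_congr_ae ?_
  filter_upwards [h] with ω hω
  rw [← lintegral_zero (μ := timeMeasure)]
  refine lintegral_congr_ae ?_
  filter_upwards [hω] with t ht
  refine ENNReal.ofReal_of_nonpos (mul_nonpos_of_nonneg_of_nonpos ?_ ht)
  have := hp.le
  unfold marginalSocialCost
  positivity

end SocialCost

/-! ### Monotonicity and scaling of the Stone-Geary disutility -/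

namespace Model

variable (m : Model)

/-- The negative of the Stone-Geary utility, as an extended nonnegative real. -/
noncomputable def disutility (x s : ℝ) : ℝ≥0∞ := (-m.utility x s).toENNReal

/-- The negative of the utility in terms of consumption in excess of subsistence. -/
noncomputable def excessDisutility (a b : ℝ) : ℝ :=
  (a ^ (1 - m.β) * b ^ m.β) ^ (1 - m.γ) / (m.γ - 1)

variable {m}

lemma disutility_of_lt {x s : ℝ} (hx : m.xSub < x) (hs : m.sSub < s) :
    m.disutility x s = ENNReal.ofReal (m.excessDisutility (x - m.xSub) (s - m.sSub)) := by
  rw [disutility, utility, if_pos ⟨hx, hs⟩, ← EReal.coe_neg, EReal.toENNReal_of_ne_top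
    (EReal.coe_ne_top _), EReal.toReal_coe, excessDisutility, ← div_neg, neg_sub]

lemma disutility_of_not {x s : ℝ} (h : ¬(m.xSub < x ∧ m.sSub < s)) : m.disutility x s = ∞ := by
  rw [disutility, utility, if_neg h]
  simp

lemma excessDisutility_pos {a b : ℝ} (ha : 0 < a) (hb : 0 < b) : 0 < m.excessDisutility a b := by
  have := m.γ_gt
  have : 0 < m.γ - 1 := by linarith
  unfold excessDisutility
  positivity

lemma excessDisutility_anti {a b a' b' : ℝ} (ha : 0 < a) (hb : 0 < b) (haa : a ≤ a')
    (hbb : b ≤ b') : m.excessDisutility a' b' ≤ m.excessDisutility a b := by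
  have h1 := m.γ_gt
  have h2 := m.β_pos
  have h3 := m.β_lt
  refine div_le_div_of_nonneg_right ?_ (by linarith)
  refine Real.rpow_le_rpow_of_nonpos (by positivity) ?_ (by linarith)
  exact mul_le_mul (Real.rpow_le_rpow ha.le haa (by linarith))
    (Real.rpow_le_rpow hb.le hbb h2.le) (by positivity) (by have := ha.trans_le haa; positivity)

/-- The exponents 1 - β and β add up to one, so the inner aggregate is homogeneous of degree one and
the outer power gives the degree 1 - γ. -/
lemma excessDisutility_smul {k a b : ℝ} (hk : 0 < k) (ha : 0 < a) (hb : 0 < b) :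
    m.excessDisutility (k * a) (k * b) = k ^ (1 - m.γ) * m.excessDisutility a b := by
  unfold excessDisutility
  have : (k * a) ^ (1 - m.β) * (k * b) ^ m.β = k * (a ^ (1 - m.β) * b ^ m.β) := by
    rw [Real.mul_rpow hk.le ha.le, Real.mul_rpow hk.le hb.le]
    have : k ^ (1 - m.β) * k ^ m.β = k := by
      rw [← Real.rpow_add hk]; simp
    calc _ = (k ^ (1 - m.β) * k ^ m.β) * (a ^ (1 - m.β) * b ^ m.β) := by ring
      _ = _ := by rw [this]
  rw [this, Real.mul_rpow hk.le (by positivity), mul_div_assoc]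

lemma disutility_le_of_scaled {k x s x' s' : ℝ} (hk : 0 < k) (hx : m.xSub < x) (hs : m.sSub < s)
    (hx' : m.xSub + k * (x - m.xSub) ≤ x') (hs' : m.sSub + k * (s - m.sSub) ≤ s') :
    m.disutility x' s' ≤ ENNReal.ofReal (k ^ (1 - m.γ)) * m.disutility x s := by
  have ha : 0 < x - m.xSub := by linarith
  have hb : 0 < s - m.sSub := by linarith
  have hka := mul_pos hk ha
  have hkb := mul_pos hk hb
  rw [disutility_of_lt (by linarith) (by linarith), disutility_of_lt hx hs,
    ← ENNReal.ofReal_mul (by positivity), ← excessDisutility_smul hk ha hb]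
  exact ENNReal.ofReal_le_ofReal (excessDisutility_anti hka hkb (by linarith) (by linarith))

/-- Signs of a and b need no separate assumption: they are positive if consumption exceeds
subsistence, and otherwise the right-hand side is infinite. -/
lemma le_disutility {a b x s : ℝ} (hx : x - m.xSub ≤ a) (hs : s - m.sSub ≤ b) :
    ENNReal.ofReal (m.excessDisutility a b) ≤ m.disutility x s := by
  by_cases h : m.xSub < x ∧ m.sSub < s
  · rw [disutility_of_lt h.1 h.2]
    exact ENNReal.ofReal_le_ofReal
      (excessDisutility_anti (by linarith [h.1]) (by linarith [h.2]) hx hs)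
  · rw [disutility_of_not h]; exact le_top

lemma measurable_disutility : Measurable (fun q : ℝ × ℝ => m.disutility q.1 q.2) := by
  have : (fun q : ℝ × ℝ => m.disutility q.1 q.2) = fun q : ℝ × ℝ =>
      if m.xSub < q.1 ∧ m.sSub < q.2 then
        ENNReal.ofReal (m.excessDisutility (q.1 - m.xSub) (q.2 - m.sSub)) else ∞ := by
    funext q
    split_ifs with h
    · exact disutility_of_lt h.1 h.2
    · exact disutility_of_not h
  rw [this]
  refine Measurable.ite ?_ ?_ measurable_const
  · exact (measurableSet_lt measurable_const measurable_fst).inter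
      (measurableSet_lt measurable_const measurable_snd)
  · unfold excessDisutility
    fun_prop

lemma δHat_pos (m : Model) : 0 < m.δHat := add_pos m.δ_pos m.hazard_pos

lemma μR_mul_H (m : Model) : m.μR * m.H = m.Y - m.xSub - m.sSub / m.η * m.price := by
  rw [H, mul_div_cancel₀ _ m.μR_pos.ne']

end Model

/-! ### Value functions as negatives of minimal losses -/

section Cost

variable {Ω : Type*} {mΩ : MeasurableSpace Ω}

/-- Expected discounted disutility. -/
noncomputable def expectedDisutility (P : Measure Ω) (m : Model) (u : Controls Ω) : ℝ≥0∞ :=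
  ∫⁻ ω, ∫⁻ t, ENNReal.ofReal (Real.exp (-m.δHat * t)) *
    m.disutility (u.x t ω) (u.s t ω) ∂timeMeasure ∂P

lemma expectedUtility_eq (P : Measure Ω) (m : Model) (u : Controls Ω) :
    expectedUtility P m u = -(expectedDisutility P m u : EReal) := rfl

/-- Minimal expected disutility in the agent's problem. -/
noncomputable def lossF (𝓕 : Filtration ℝ≥0 mΩ) (P : Measure Ω) (B : ℝ≥0 → Ω → ℝ) (m : Model)
    (w : ℝ) : ℝ≥0∞ :=
  ⨅ (τ : Ω → WithTop ℝ≥0) (u : Controls Ω) (W : ℝ≥0 → Ω → ℝ)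
    (_ : IsAdmissible 𝓕 P B m w τ u W), expectedDisutility P m u

/-- Minimal expected disutility in the counterfactual problem. -/
noncomputable def lossFHat (𝓕 : Filtration ℝ≥0 mΩ) (P : Measure Ω) (B : ℝ≥0 → Ω → ℝ) (m : Model)
    (w : ℝ) : ℝ≥0∞ :=
  ⨅ (u : Controls Ω) (W : ℝ≥0 → Ω → ℝ)
    (_ : IsAdmissible 𝓕 P B m w never u W), expectedDisutility P m u

/-- Negation after the coercion is continuous and antitone and sends ∞ to `⊥`, which also covers an
empty family of plans. -/
lemma neg_coe_iInf {ι : Sort*} (f : ι → ℝ≥0∞) :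
    -((⨅ i, f i : ℝ≥0∞) : EReal) = ⨆ i, -(f i : EReal) := by
  have hanti : Antitone (fun x : ℝ≥0∞ => -(x : EReal)) := fun a b h =>
    EReal.neg_le_neg_iff.2 (EReal.coe_ennreal_le_coe_ennreal_iff.2 h)
  refine Antitone.map_iInf_of_continuousAt (f := fun x : ℝ≥0∞ => -(x : EReal)) ?_ hanti ?_
  · exact (continuous_neg.comp continuous_coe_ennreal_ereal).continuousAt
  · simp

lemma valueF_eq (𝓕 : Filtration ℝ≥0 mΩ) (P : Measure Ω) (B : ℝ≥0 → Ω → ℝ) (m : Model) (w : ℝ) :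
    valueF 𝓕 P B m w = -(lossF 𝓕 P B m w : EReal) := by
  simp only [valueF, lossF, neg_coe_iInf, expectedUtility_eq]

lemma valueFHat_eq (𝓕 : Filtration ℝ≥0 mΩ) (P : Measure Ω) (B : ℝ≥0 → Ω → ℝ) (m : Model)
    (w : ℝ) : valueFHat 𝓕 P B m w = -(lossFHat 𝓕 P B m w : EReal) := by
  simp only [valueFHat, lossFHat, neg_coe_iInf, expectedUtility_eq]

lemma lossF_le_lossFHat (𝓕 : Filtration ℝ≥0 mΩ) (P : Measure Ω) (B : ℝ≥0 → Ω → ℝ) (m : Model)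
    (w : ℝ) : lossF 𝓕 P B m w ≤ lossFHat 𝓕 P B m w :=
  iInf_le _ never

end Cost

/-! ### Scaling of Itô integrals -/

section ItoScaling

variable {Ω : Type*} {mΩ : MeasurableSpace Ω} {𝓕 : Filtration ℝ≥0 mΩ}

/-- Scalar multiples of simple integrands. -/
def SimpleIntegrand.smul (k : ℝ) (V : SimpleIntegrand 𝓕) : SimpleIntegrand 𝓕 where
  n := V.n
  time := V.time
  ξ i ω := k * V.ξ i ω
  time_mono := V.time_mono
  meas i := (V.meas i).const_mul k
  bdd i := by
    obtain ⟨C, hC⟩ := V.bdd i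
    refine ⟨|k| * C, fun ω => ?_⟩
    rw [abs_mul]
    exact mul_le_mul_of_nonneg_left (hC ω) (abs_nonneg k)

lemma SimpleIntegrand.smul_process (k : ℝ) (V : SimpleIntegrand 𝓕) (t : ℝ≥0) (ω : Ω) :
    (V.smul k).process t ω = k * V.process t ω := by
  simp only [process, smul, Finset.mul_sum, Set.indicator_apply]
  exact Finset.sum_congr rfl fun i _ => by split_ifs <;> simp

lemma SimpleIntegrand.smul_integral (k : ℝ) (V : SimpleIntegrand 𝓕) (B : ℝ≥0 → Ω → ℝ) (t : ℝ≥0)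
    (ω : Ω) : (V.smul k).integral B t ω = k * V.integral B t ω := by
  simp only [integral, smul, Finset.mul_sum, mul_assoc]

/-- The scaled simple processes approximate, with thresholds c / k² and c / k. Only almost
everywhere equality of the integrands is asked for, because the scaled share breaks down where the
new wealth is zero. -/
lemma IsItoIntegral.const_mul_congr {P : Measure Ω} {B A M A' : ℝ≥0 → Ω → ℝ}
    (h : IsItoIntegral 𝓕 P B A M) {k : ℝ} (hk : 0 < k) (hA' : IsStronglyProgressive 𝓕 A')
    (hAA' : ∀ᵐ ω ∂P, ∀ᵐ t ∂timeMeasure, A' t ω = k * A t ω) :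
    IsItoIntegral 𝓕 P B A' (fun t ω => k * M t ω) where
  integrand_prog := hA'
  cont := by
    filter_upwards [h.cont] with ω hω using hω.const_mul k
  approx := by
    obtain ⟨V, hV⟩ := h.approx
    have hk2 : ENNReal.ofReal (k ^ 2) ≠ 0 := by
      rw [ne_eq, ENNReal.ofReal_eq_zero, not_le]; positivity
    refine ⟨fun j => (V j).smul k, fun T => ⟨fun c hc => ?_, fun c hc => ?_⟩⟩
    · have hc' : 0 < c / ENNReal.ofReal (k ^ 2) := ENNReal.div_pos hc.ne' ENNReal.ofReal_ne_top
      refine ((hV T).1 _ hc').congr fun j => measure_congr ?_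
      filter_upwards [hAA'] with ω hω
      have : ∫⁻ t in Set.Iic T, ENNReal.ofReal ((((V j).smul k).process t ω - A' t ω) ^ 2)
          ∂timeMeasure = (∫⁻ t in Set.Iic T, ENNReal.ofReal (((V j).process t ω - A t ω) ^ 2)
          ∂timeMeasure) * ENNReal.ofReal (k ^ 2) := by
        rw [← lintegral_mul_const' _ _ ENNReal.ofReal_ne_top]
        refine lintegral_congr_ae ?_
        filter_upwards [ae_restrict_of_ae hω] with t ht
        rw [ht, SimpleIntegrand.smul_process, ← ENNReal.ofReal_mul (sq_nonneg _)]
        congr 1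
        ring
      apply propext
      change c / ENNReal.ofReal (k ^ 2) ≤ _ ↔ c ≤ _
      rw [this, ENNReal.div_le_iff hk2 ENNReal.ofReal_ne_top]
    · refine ((hV T).2 (c / k) (by positivity)).congr fun j => ?_
      congr 1
      ext ω
      simp only [Set.mem_ofPred_eq, SimpleIntegrand.smul_integral]
      refine exists_congr fun t => and_congr_right fun _ => ?_
      rw [← mul_sub, abs_mul, abs_of_pos hk, div_le_iff₀ hk, mul_comm k]

end ItoScaling

/-! ### Homogeneity of the counterfactual problem -/

section Homogeneity

variable {Ω : Type*} {mΩ : MeasurableSpace Ω} {𝓕 : Filtration ℝ≥0 mΩ} {P : Measure Ω}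
  {B : ℝ≥0 → Ω → ℝ} {m : Model}

lemma IsStronglyProgressive.comp_measurable {ι : Type*} [Preorder ι] [MeasurableSpace ι]
    {𝓖 : Filtration ι mΩ} {X : ι → Ω → ℝ} (hX : IsStronglyProgressive 𝓖 X)
    {f : ι × ℝ → ℝ} (hf : Measurable f) :
    IsStronglyProgressive 𝓖 (fun t ω => f (t, X t ω)) := by
  intro i
  refine Measurable.stronglyMeasurable ?_
  refine hf.comp (Measurable.prodMk ?_ (hX i).measurable)
  exact measurable_subtype_coe.comp measurable_fst

lemma measurable_discounted_disutility {u : Controls Ω} (hx : IsStronglyProgressive 𝓕 u.x)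
    (hs : IsStronglyProgressive 𝓕 u.s) :
    Measurable (fun q : Ω × ℝ≥0 => ENNReal.ofReal (Real.exp (-m.δHat * q.2)) *
      m.disutility (u.x q.2 q.1) (u.s q.2 q.1)) := by
  refine Measurable.mul ?_ ?_
  · have : Measurable (fun q : Ω × ℝ≥0 => (q.2 : ℝ)) := measurable_snd.coe_nnreal_real
    exact ((this.const_mul _).exp).ennreal_ofReal
  · exact Model.measurable_disutility.comp
      (((measurable_uncurry_of_prog hx).comp measurable_swap).prodMk
        ((measurable_uncurry_of_prog hs).comp measurable_swap))

/-- Plans of finite disutility consume above subsistence almost everywhere. -/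
lemma ae_above_subsistence {u : Controls Ω} (hx : IsStronglyProgressive 𝓕 u.x)
    (hs : IsStronglyProgressive 𝓕 u.s) (hfin : expectedDisutility P m u ≠ ∞) :
    ∀ᵐ ω ∂P, ∀ᵐ t ∂timeMeasure, m.xSub < u.x t ω ∧ m.sSub < u.s t ω := by
  have hmeas := measurable_discounted_disutility (m := m) hx hs
  filter_upwards [ae_lt_top hmeas.lintegral_prod_right' hfin] with ω hω
  have hm : Measurable (fun t : ℝ≥0 => ENNReal.ofReal (Real.exp (-m.δHat * t)) *
      m.disutility (u.x t ω) (u.s t ω)) := hmeas.comp (measurable_const.prodMk measurable_id)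
  filter_upwards [ae_lt_top hm hω.ne] with t ht
  by_contra hcon
  rw [Model.disutility_of_not hcon, ENNReal.mul_top] at ht
  · exact lt_irrefl _ ht
  · rw [ne_eq, ENNReal.ofReal_eq_zero, not_le]; positivity

/-- A measurable process avoids almost every member of a family of exponentially decaying
barriers. -/
lemma exists_rate_avoiding [IsProbabilityMeasure P] {X : ℝ≥0 → Ω → ℝ}
    (hX : Measurable (fun q : ℝ≥0 × Ω => X q.1 q.2)) {D : ℝ} (hD : 0 < D) :
    ∃ c : ℝ, 0 < c ∧ ∀ᵐ ω ∂P, ∀ᵐ t ∂timeMeasure, X t ω + D * Real.exp (-c * t) ≠ 0 := by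
  set S : Set.Ioi (0 : ℝ) → Set (ℝ≥0 × Ω) := fun c =>
    {q | q.1 ≠ 0 ∧ X q.1 q.2 + D * Real.exp (-c * q.1) = 0} with hS
  have hSm : ∀ c, MeasurableSet (S c) := by
    intro c
    refine MeasurableSet.inter ?_ ?_
    · exact (measurable_fst (measurableSet_singleton (0 : ℝ≥0))).compl
    · refine measurableSet_eq_fun ?_ measurable_const
      refine hX.add ?_
      have : Measurable (fun q : ℝ≥0 × Ω => (q.1 : ℝ)) := measurable_fst.coe_nnreal_real
      fun_prop
  -- For t ≠ 0 the exponential determines c, so different rates give disjoint zero sets. A σ-finite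
  -- measure charges only countably many of them, whereas there are uncountably many rates.
  have hdisj : Pairwise (Function.onFun Disjoint S) := by
    intro c d hcd
    refine Set.disjoint_left.2 fun q hq hq' => hcd ?_
    have h1 : Real.exp (-c * q.1) = Real.exp (-d * q.1) := by
      have := hq.2
      have := hq'.2
      have h3 : D * (Real.exp (-c * q.1) - Real.exp (-d * q.1)) = 0 := by linarith
      rcases mul_eq_zero.1 h3 with h | h
      · exact absurd h hD.ne'
      · linarith
    have h2 := Real.exp_injective h1
    have hq0 : (q.1 : ℝ) ≠ 0 := NNReal.coe_ne_zero.2 hq.1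
    have := mul_right_cancel₀ hq0 h2
    exact Subtype.ext (by linarith)
  have hcount := Measure.countable_meas_pos_of_disjoint_iUnion (μ := timeMeasure.prod P) hSm hdisj
  have hunc : ¬ (Set.univ : Set (Set.Ioi (0 : ℝ))).Countable := by
    rw [Set.countable_univ_iff]
    intro h
    have h0 := Cardinal.mk_le_aleph0_iff.2 h
    rw [Cardinal.mk_Ioi_real] at h0
    exact absurd h0 (not_le.2 Cardinal.aleph0_lt_continuum)
  obtain ⟨c, hc⟩ : ∃ c, (timeMeasure.prod P) (S c) = 0 := by
    by_contra hcon
    push Not at hcon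
    refine hunc (hcount.mono fun c _ => pos_iff_ne_zero.2 (hcon c))
  refine ⟨c, c.2, ?_⟩
  have h1 : ∀ᵐ q ∂(timeMeasure.prod P), q ∉ S c := measure_eq_zero_iff_ae_notMem.1 hc
  have h2 : ∀ᵐ ω ∂P, ∀ᵐ t ∂timeMeasure, (t, ω) ∉ S c := by
    refine (Measure.ae_ae_comm (μ := timeMeasure) (ν := P)
      (p := fun t ω => (t, ω) ∉ S c) ?_).1 (Measure.ae_ae_of_ae_prod h1)
    exact (hSm c).compl
  have h3 : ∀ᵐ t ∂timeMeasure, t ≠ 0 := by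
    rw [ae_iff]; simp
  filter_upwards [h2] with ω hω
  filter_upwards [hω, h3] with t ht ht0 hcon
  exact ht ⟨ht0, hcon⟩

/-- The controls obtained from `u` by scaling disposable capital by `k` and adding a capital stock
`D` that is consumed at rate `c`; `W'` is the new wealth. -/
noncomputable def scaledControls (m : Model) (k D c : ℝ) (u : Controls Ω) (W W' : ℝ≥0 → Ω → ℝ) :
    Controls Ω where
  a t ω := k * (u.a t ω * W t ω) / W' t ω
  x t ω := max 0 (m.xSub + k * (u.x t ω - m.xSub) + (m.μR + c) * (D * Real.exp (-c * t)))
  s t ω := max 0 (m.sSub + k * (u.s t ω - m.sSub))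

/-- The wealth belonging to `scaledControls`. -/
noncomputable def scaledWealth (m : Model) (k D c : ℝ) (W : ℝ≥0 → Ω → ℝ) (t : ℝ≥0) (ω : Ω) : ℝ :=
  k * (W t ω + m.H) - m.H + D * Real.exp (-c * t)

lemma wealthDrift_never (u : Controls Ω) (W : ℝ≥0 → Ω → ℝ) (t : ℝ≥0) (ω : Ω) :
    wealthDrift m never u W t ω = u.a t ω * m.μS * W t ω + (1 - u.a t ω) * m.μR * W t ω
      + (m.Y - u.x t ω) - u.s t ω / m.η * m.price := by
  rw [wealthDrift, if_pos (show (t : WithTop ℝ≥0) < never ω from WithTop.coe_lt_top t)]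

/-- Above subsistence the truncations at 0 are inactive, and the drift is affine in (aW, W, x, s).
Subsistence spending net of income is exactly the interest on -H, so scaling about -H is consistent;
interest on D e^(-ct) and its depletion pay for the additional consumption. -/
lemma wealthDrift_scaled {k D c : ℝ} (hk : 0 < k) (hD : 0 < D) (hc : 0 < c) {u : Controls Ω}
    {W : ℝ≥0 → Ω → ℝ} {t : ℝ≥0} {ω : Ω} (hW : scaledWealth m k D c W t ω ≠ 0)
    (hx : m.xSub < u.x t ω) (hs : m.sSub < u.s t ω) :
    wealthDrift m never (scaledControls m k D c u W (scaledWealth m k D c W))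
      (scaledWealth m k D c W) t ω =
    k * wealthDrift m never u W t ω + -c * (D * Real.exp (-c * t)) := by
  have h1 := m.xSub_pos
  have h2 := m.sSub_pos
  have h3 := m.μR_pos
  have hx' : 0 ≤ k * (u.x t ω - m.xSub) := mul_nonneg hk.le (by linarith)
  have hs' : 0 ≤ k * (u.s t ω - m.sSub) := mul_nonneg hk.le (by linarith)
  have hE : 0 ≤ (m.μR + c) * (D * Real.exp (-c * t)) := by positivity
  rw [wealthDrift_never, wealthDrift_never]
  simp only [scaledControls]
  rw [max_eq_right (by linarith), max_eq_right (by linarith)]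
  set Z := scaledWealth m k D c W t ω with hZ
  have e1 : k * (u.a t ω * W t ω) / Z * m.μS * Z + (1 - k * (u.a t ω * W t ω) / Z) * m.μR * Z =
      k * (u.a t ω * W t ω) * (m.μS - m.μR) + m.μR * Z := by
    field_simp
    ring
  have e2 : m.μR * Z = k * (m.μR * W t ω) + (k - 1) * (m.μR * m.H)
      + m.μR * (D * Real.exp (-c * t)) := by
    rw [hZ, scaledWealth]; ring
  rw [e1, e2, m.μR_mul_H]
  ring

lemma integral_exp_decay (D c : ℝ) (t : ℝ≥0) :
    ∫ r in Set.Iic t, -c * (D * Real.exp (-c * r)) ∂timeMeasure = D * Real.exp (-c * t) - D := by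
  rw [setIntegral_Iic_timeMeasure (fun r => -c * (D * Real.exp (-c * r)))]
  have hderiv : ∀ x ∈ Set.uIcc (0 : ℝ) t,
      HasDerivAt (fun r => D * Real.exp (-c * r)) (-c * (D * Real.exp (-c * x))) x := by
    intro x _
    have h1 : HasDerivAt (fun r : ℝ => -c * r) (-c) x := by
      simpa using (hasDerivAt_id x).const_mul (-c)
    have := (h1.exp).const_mul D
    exact this.congr_deriv (by ring)
  rw [intervalIntegral.integral_eq_sub_of_hasDerivAt hderiv]
  · simp
  · exact Continuous.intervalIntegrable (by fun_prop) _ _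

lemma isAdmissible_scaled [IsProbabilityMeasure P] {w k D c : ℝ} (hk : 0 < k) (hD : 0 < D)
    (hc : 0 < c) {u : Controls Ω} {W : ℝ≥0 → Ω → ℝ} (h : IsAdmissible 𝓕 P B m w never u W)
    (hsub : ∀ᵐ ω ∂P, ∀ᵐ t ∂timeMeasure, m.xSub < u.x t ω ∧ m.sSub < u.s t ω)
    (hne : ∀ᵐ ω ∂P, ∀ᵐ t ∂timeMeasure, scaledWealth m k D c W t ω ≠ 0) :
    IsAdmissible 𝓕 P B m (k * (w + m.H) + D - m.H) never
      (scaledControls m k D c u W (scaledWealth m k D c W)) (scaledWealth m k D c W) := by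
  have hWprog : IsStronglyProgressive 𝓕 (scaledWealth m k D c W) :=
    IsStronglyProgressive.comp_measurable h.wealth.prog
      (f := fun q => k * (q.2 + m.H) - m.H + D * Real.exp (-c * q.1)) (by fun_prop)
  have haprog : IsStronglyProgressive 𝓕
      (scaledControls m k D c u W (scaledWealth m k D c W)).a := by
    intro i
    have h1 := (h.a_prog i).measurable
    have h2 := (h.wealth.prog i).measurable
    have h3 := (hWprog i).measurable
    exact (((h1.mul h2).const_mul k).div h3).stronglyMeasurable
  have hdrift : ∀ᵐ ω ∂P, ∀ᵐ t ∂timeMeasure,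
      wealthDrift m never (scaledControls m k D c u W (scaledWealth m k D c W))
        (scaledWealth m k D c W) t ω =
      k * wealthDrift m never u W t ω + -c * (D * Real.exp (-c * t)) := by
    filter_upwards [hsub, hne] with ω h1 h2
    filter_upwards [h1, h2] with t h3 h4
    exact wealthDrift_scaled hk hD hc h4 h3.1 h3.2
  have hexpcont : Continuous (fun r : ℝ≥0 => -c * (D * Real.exp (-c * r))) := by fun_prop
  refine ⟨h.stopping, haprog, ?_, ?_, fun _ _ => le_max_left _ _, fun _ _ => le_max_left _ _,
    ⟨hWprog, ?_, ?_, ?_⟩, ?_⟩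
  · exact IsStronglyProgressive.comp_measurable h.x_prog
      (f := fun q => max 0 (m.xSub + k * (q.2 - m.xSub) + (m.μR + c) * (D * Real.exp (-c * q.1))))
      (by fun_prop)
  · exact IsStronglyProgressive.comp_measurable h.s_prog
      (f := fun q => max 0 (m.sSub + k * (q.2 - m.sSub))) (by fun_prop)
  · filter_upwards [h.wealth.cont] with ω hω
    unfold scaledWealth
    fun_prop
  · filter_upwards [h.wealth.drift_integrable, hdrift] with ω h1 h2 t
    refine Integrable.congr (((h1 t).const_mul k).add
      (continuous_integrableOn_Iic hexpcont t)) ?_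
    filter_upwards [ae_restrict_of_ae h2] with r hr
    exact hr.symm
  · obtain ⟨M, hM, hMeq⟩ := h.wealth.eqn
    refine ⟨fun t ω => k * M t ω, hM.const_mul_congr hk ?_ ?_, ?_⟩
    · intro i
      exact (((haprog i).measurable.mul_const m.σS).mul (hWprog i).measurable).stronglyMeasurable
    · filter_upwards [hne] with ω hω
      filter_upwards [hω] with t ht
      simp only [scaledControls]
      field_simp
    · filter_upwards [hMeq, hdrift, h.wealth.drift_integrable] with ω h1 h2 h3 t
      rw [setIntegral_congr_ae (g := fun r => k * wealthDrift m never u W r ω +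
        -c * (D * Real.exp (-c * r))) measurableSet_Iic (h2.mono fun r hr _ => hr),
        integral_add ((h3 t).const_mul k) (continuous_integrableOn_Iic hexpcont t),
        integral_const_mul, integral_exp_decay, scaledWealth, h1 t]
      ring
  · filter_upwards [h.capital_pos] with ω hω t
    have := hω t
    simp only [never, WithTop.coe_lt_top, if_true] at this ⊢
    rw [scaledWealth]
    have : 0 < D * Real.exp (-c * t) := by positivity
    nlinarith

lemma expectedDisutility_scaled_le {k D c : ℝ} (hk : 0 < k) (hD : 0 < D)
    (hc : 0 < c) {u : Controls Ω} {W W' : ℝ≥0 → Ω → ℝ}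
    (hsub : ∀ᵐ ω ∂P, ∀ᵐ t ∂timeMeasure, m.xSub < u.x t ω ∧ m.sSub < u.s t ω) :
    expectedDisutility P m (scaledControls m k D c u W W') ≤
      ENNReal.ofReal (k ^ (1 - m.γ)) * expectedDisutility P m u := by
  rw [expectedDisutility, expectedDisutility, ← lintegral_const_mul' _ _ ENNReal.ofReal_ne_top]
  refine lintegral_mono_ae ?_
  filter_upwards [hsub] with ω hω
  rw [← lintegral_const_mul' _ _ ENNReal.ofReal_ne_top]
  refine lintegral_mono_ae ?_
  filter_upwards [hω] with t ht
  rw [mul_left_comm]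
  gcongr
  refine Model.disutility_le_of_scaled hk ht.1 ht.2 (le_max_of_le_right ?_)
    (le_max_of_le_right le_rfl)
  have := m.μR_pos
  have : 0 ≤ (m.μR + c) * (D * Real.exp (-c * t)) := by positivity
  linarith

lemma lossFHat_le {w : ℝ} {u : Controls Ω} {W : ℝ≥0 → Ω → ℝ}
    (h : IsAdmissible 𝓕 P B m w never u W) :
    lossFHat 𝓕 P B m w ≤ expectedDisutility P m u :=
  iInf_le_of_le u (iInf_le_of_le W (iInf_le _ h))

/-- The strict inequality leaves room for the extra capital D that keeps the new wealth away from
zero. Plans of infinite disutility satisfy the bound trivially, and all others consume above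
subsistence almost everywhere. -/
lemma lossFHat_le_of_lt [IsProbabilityMeasure P] {w w' k : ℝ} (hk : 0 < k)
    (hlt : k * (w + m.H) < w' + m.H) :
    lossFHat 𝓕 P B m w' ≤ ENNReal.ofReal (k ^ (1 - m.γ)) * lossFHat 𝓕 P B m w := by
  have hk' : ENNReal.ofReal (k ^ (1 - m.γ)) ≠ 0 := by
    rw [ne_eq, ENNReal.ofReal_eq_zero, not_le]; positivity
  conv_rhs => rw [lossFHat]
  simp only [ENNReal.mul_iInf_of_ne hk' ENNReal.ofReal_ne_top]
  refine le_iInf fun u => le_iInf fun W => le_iInf fun h => ?_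
  by_cases hfin : expectedDisutility P m u = ∞
  · rw [hfin, ENNReal.mul_top hk']; exact le_top
  have hsub := ae_above_subsistence h.x_prog h.s_prog hfin
  have hD : 0 < w' + m.H - k * (w + m.H) := by linarith
  have hmeas : Measurable (fun q : ℝ≥0 × Ω => k * (W q.1 q.2 + m.H) - m.H) :=
    (((measurable_uncurry_of_prog h.wealth.prog).add_const _).const_mul k).sub_const _
  obtain ⟨c, hc, hne⟩ := exists_rate_avoiding (P := P)
    (X := fun t ω => k * (W t ω + m.H) - m.H) hmeas hD
  have hadm := isAdmissible_scaled hk hD hc h hsub hne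
  rw [show k * (w + m.H) + (w' + m.H - k * (w + m.H)) - m.H = w' by ring] at hadm
  exact (lossFHat_le hadm).trans (expectedDisutility_scaled_le hk hD hc hsub)

/-- Homogeneity of the counterfactual value function in disposable capital. -/
lemma lossFHat_le_homogeneous [IsProbabilityMeasure P] {w w' : ℝ} (hw : -m.H < w)
    (hw' : -m.H < w') :
    lossFHat 𝓕 P B m w' ≤
      ENNReal.ofReal (((w' + m.H) / (w + m.H)) ^ (1 - m.γ)) * lossFHat 𝓕 P B m w := by
  have h1 : 0 < w + m.H := by linarith
  have h2 : 0 < w' + m.H := by linarith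
  set k₀ := (w' + m.H) / (w + m.H) with hk₀
  have hpos : 0 < k₀ := by positivity
  have hcont : Tendsto (fun k : ℝ => ENNReal.ofReal (k ^ (1 - m.γ)) * lossFHat 𝓕 P B m w)
      (𝓝[<] k₀) (𝓝 (ENNReal.ofReal (k₀ ^ (1 - m.γ)) * lossFHat 𝓕 P B m w)) := by
    -- The limit of the factor is nonzero, so multiplication is continuous even if the loss is
    -- infinite.
    refine ENNReal.Tendsto.mul_const ?_ (Or.inl ?_)
    · refine (ENNReal.continuous_ofReal.tendsto _).comp ?_
      exact ((Real.continuousAt_rpow_const _ _ (Or.inl hpos.ne')).tendsto).mono_left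
        nhdsWithin_le_nhds
    · rw [ne_eq, ENNReal.ofReal_eq_zero, not_le]; positivity
  refine ge_of_tendsto hcont ?_
  filter_upwards [self_mem_nhdsWithin,
    mem_nhdsWithin_of_mem_nhds (Ioi_mem_nhds hpos)] with k hk hk0
  refine lossFHat_le_of_lt hk0 ?_
  rw [hk₀] at hk
  exact (lt_div_iff₀ h1).1 hk

end Homogeneity

/-! ### Girsanov's theorem for a constant drift -/

section Girsanov

variable {Ω : Type*} {mΩ : MeasurableSpace Ω} {𝓕 : Filtration ℝ≥0 mΩ} {P : Measure Ω}
  {B : ℝ≥0 → Ω → ℝ}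

/-- Up to time `T`, the adapted process `X` has independent Gaussian increments with variance
equal to elapsed time. -/
structure HasBrownianIncrements (𝓕 : Filtration ℝ≥0 mΩ) (Q : Measure Ω) (T : ℝ≥0)
    (X : ℝ≥0 → Ω → ℝ) : Prop where
  adapted : ∀ t, Measurable[𝓕 t] (X t)
  law : ∀ s t : ℝ≥0, s ≤ t → t ≤ T →
    HasLaw (fun ω => X t ω - X s ω) (gaussianReal 0 (t - s)) Q
  indep : ∀ s t : ℝ≥0, s ≤ t → t ≤ T →
    Indep (MeasurableSpace.comap (fun ω => X t ω - X s ω) inferInstance) (𝓕 s) Q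

/-- Increment over `[a, b]` of the exponential martingale with parameter `-κ`. -/
noncomputable def expFactor (κ : ℝ) (B : ℝ≥0 → Ω → ℝ) (a b : ℝ≥0) (ω : Ω) : ℝ≥0∞ :=
  ENNReal.ofReal (Real.exp (-κ * (B b ω - B a ω) - κ ^ 2 / 2 * ((b : ℝ) - a)))

/-- The measure under which `B t + κ t` is a Brownian motion up to time `T`. -/
noncomputable def driftRemovingMeasure (κ : ℝ) (P : Measure Ω) (B : ℝ≥0 → Ω → ℝ) (T : ℝ≥0) :
    Measure Ω :=
  P.withDensity (expFactor κ B 0 T)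

lemma expFactor_mul (κ : ℝ) (B : ℝ≥0 → Ω → ℝ) (a b c : ℝ≥0) (ω : Ω) :
    expFactor κ B a b ω * expFactor κ B b c ω = expFactor κ B a c ω := by
  rw [expFactor, expFactor, expFactor, ← ENNReal.ofReal_mul (Real.exp_pos _).le, ← Real.exp_add]
  congr 2
  ring

/-- Completing the square: the exponential weight turns the centred Gaussian density at x into the
density at x + κh. Translation invariance of Lebesgue measure does the rest; variance zero is a
Dirac mass and is treated apart. -/
lemma lintegral_gaussian_exp_shift (κ : ℝ) (h : ℝ≥0) {f : ℝ → ℝ≥0∞} (hf : Measurable f) :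
    ∫⁻ x, ENNReal.ofReal (Real.exp (-κ * x - κ ^ 2 / 2 * h)) * f (x + κ * h) ∂gaussianReal 0 h =
      ∫⁻ x, f x ∂gaussianReal 0 h := by
  by_cases hh : h = 0
  · subst hh
    have hm : Measurable (fun x : ℝ => ENNReal.ofReal (Real.exp (-κ * x - κ ^ 2 / 2 * (0 : ℝ≥0))) *
        f (x + κ * (0 : ℝ≥0))) := by fun_prop
    rw [gaussianReal_zero_var, lintegral_dirac' _ hm, lintegral_dirac' _ hf]
    simp
  · have hpos : (0 : ℝ) < h := by exact_mod_cast pos_iff_ne_zero.2 hh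
    rw [gaussianReal_of_var_ne_zero _ hh,
      lintegral_withDensity_eq_lintegral_mul _ (measurable_gaussianPDF _ _) (by fun_prop),
      lintegral_withDensity_eq_lintegral_mul _ (measurable_gaussianPDF _ _) hf]
    refine Eq.trans ?_
      (lintegral_add_right_eq_self (fun x => (gaussianPDF 0 h * f) x) (κ * (h : ℝ)))
    refine lintegral_congr fun x => ?_
    simp only [Pi.mul_apply]
    rw [← mul_assoc]
    congr 1
    rw [gaussianPDF, gaussianPDF, ← ENNReal.ofReal_mul (gaussianPDFReal_nonneg _ _ _),
      gaussianPDFReal, gaussianPDFReal, mul_assoc, ← Real.exp_add]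
    congr 3
    field_simp
    ring

lemma IsBrownianFor.measurable (hB : IsBrownianFor 𝓕 P B) (t : ℝ≥0) : Measurable[𝓕 t] (B t) :=
  (hB.adapted t).measurable

lemma IsBrownianFor.measurable' (hB : IsBrownianFor 𝓕 P B) (t : ℝ≥0) : Measurable (B t) :=
  (hB.measurable t).mono (𝓕.le t) le_rfl

lemma IsBrownianFor.hasLaw_sub (hB : IsBrownianFor 𝓕 P B) {s t : ℝ≥0} (hst : s ≤ t) :
    HasLaw (fun ω => B t ω - B s ω) (gaussianReal 0 (t - s)) P := by
  have h := hB.brownian.toIsPreBrownianReal.hasLaw_sub t s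
  have e : nndist t.1 s.1 = t - s := by
    apply NNReal.coe_injective
    rw [coe_nndist, Real.dist_eq, NNReal.coe_sub hst]
    refine abs_of_nonneg ?_
    exact sub_nonneg.2 (by exact_mod_cast hst)
  rw [e] at h
  exact h

lemma measurable_expFactor (hB : IsBrownianFor 𝓕 P B) (κ : ℝ) {a b : ℝ≥0} (hab : a ≤ b) :
    Measurable[𝓕 b] (expFactor κ B a b) := by
  have h1 := hB.measurable b
  have h2 : Measurable[𝓕 b] (B a) := (hB.measurable a).mono (𝓕.mono hab) le_rfl
  exact (((h1.sub h2).const_mul (-κ)).sub_const _).exp.ennreal_ofReal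

lemma IsBrownianFor.lintegral_mul (hB : IsBrownianFor 𝓕 P B) {s t : ℝ≥0} (hst : s ≤ t)
    {G : Ω → ℝ≥0∞} (hG : Measurable[𝓕 s] G) {f : ℝ → ℝ≥0∞} (hf : Measurable f) :
    ∫⁻ ω, G ω * f (B t ω - B s ω) ∂P =
      (∫⁻ ω, G ω ∂P) * ∫⁻ x, f x ∂gaussianReal 0 (t - s) := by
  have hd : Measurable (fun ω => B t ω - B s ω) := (hB.measurable' t).sub (hB.measurable' s)
  rw [← (hB.hasLaw_sub hst).lintegral_comp hf.aemeasurable]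
  exact lintegral_mul_eq_lintegral_mul_lintegral_of_independent_measurableSpace (𝓕.le s)
    hd.comap_le (hB.indep s t hst).symm hG (hf.comp (comap_measurable _))

lemma lintegral_expFactor_mul (hB : IsBrownianFor 𝓕 P B) (κ : ℝ) {s t : ℝ≥0}
    (hst : s ≤ t) {G : Ω → ℝ≥0∞} (hG : Measurable[𝓕 s] G) {f : ℝ → ℝ≥0∞} (hf : Measurable f) :
    ∫⁻ ω, G ω * (expFactor κ B s t ω * f ((B t ω + κ * t) - (B s ω + κ * s))) ∂P =
      (∫⁻ ω, G ω ∂P) * ∫⁻ x, f x ∂gaussianReal 0 (t - s) := by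
  have h := hB.lintegral_mul hst hG (f := fun x =>
    ENNReal.ofReal (Real.exp (-κ * x - κ ^ 2 / 2 * ((t - s : ℝ≥0) : ℝ))) *
      f (x + κ * ((t - s : ℝ≥0) : ℝ))) (by fun_prop)
  rw [lintegral_gaussian_exp_shift κ _ hf] at h
  rw [← h]
  refine lintegral_congr fun ω => ?_
  rw [expFactor, NNReal.coe_sub hst]
  congr 3
  ring

lemma lintegral_driftRemovingMeasure (hB : IsBrownianFor 𝓕 P B) (κ : ℝ) {s t T : ℝ≥0}
    (hst : s ≤ t) (htT : t ≤ T) {g : Ω → ℝ≥0∞} (hg : Measurable[𝓕 s] g) {f : ℝ → ℝ≥0∞}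
    (hf : Measurable f) :
    ∫⁻ ω, g ω * f ((B t ω + κ * t) - (B s ω + κ * s)) ∂(driftRemovingMeasure κ P B T) =
      (∫⁻ ω, expFactor κ B 0 s ω * g ω ∂P) * ∫⁻ x, f x ∂gaussianReal 0 (t - s) := by
  have hBs : Measurable[𝓕 t] (B s) := (hB.measurable s).mono (𝓕.mono hst) le_rfl
  have hgt : Measurable[𝓕 t] g := hg.mono (𝓕.mono hst) le_rfl
  have hft : Measurable[𝓕 t] (fun ω => f ((B t ω + κ * t) - (B s ω + κ * s))) :=
    hf.comp (((hB.measurable t).add_const _).sub (hBs.add_const _))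
  have h0s : Measurable[𝓕 t] (expFactor κ B 0 s) :=
    (measurable_expFactor hB κ zero_le).mono (𝓕.mono hst) le_rfl
  have h0 := lintegral_withDensity_eq_lintegral_mul P
    ((measurable_expFactor hB κ zero_le).mono (𝓕.le T) le_rfl : Measurable (expFactor κ B 0 T))
    (g := fun ω => g ω * f ((B t ω + κ * t) - (B s ω + κ * s)))
    ((hgt.mul hft).mono (𝓕.le t) le_rfl)
  refine h0.trans ?_
  -- The density factors over [0, s], [s, t] and [t, T]. Taking f = 1 here integrates the last
  -- factor to one, and `h2` handles the middle one.
  have h1 := lintegral_expFactor_mul hB κ htT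
    (G := fun ω => expFactor κ B 0 s ω * g ω *
      (expFactor κ B s t ω * f ((B t ω + κ * t) - (B s ω + κ * s))))
    ((h0s.mul hgt).mul ((measurable_expFactor hB κ hst).mul hft)) (f := fun _ => 1)
    measurable_const
  have h2 := lintegral_expFactor_mul hB κ hst
    (G := fun ω => expFactor κ B 0 s ω * g ω)
    ((measurable_expFactor hB κ zero_le).mul hg) hf
  rw [← h2]
  simp only [mul_one, lintegral_const, measure_univ] at h1
  rw [← h1]
  refine lintegral_congr fun ω => ?_
  simp only [Pi.mul_apply]
  rw [← expFactor_mul κ B 0 s T, ← expFactor_mul κ B s t T]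
  ring

lemma lintegral_driftRemovingMeasure' [IsProbabilityMeasure P] (hB : IsBrownianFor 𝓕 P B) (κ : ℝ)
    {s t T : ℝ≥0} (hst : s ≤ t) (htT : t ≤ T) {g : Ω → ℝ≥0∞} (hg : Measurable[𝓕 s] g)
    {f : ℝ → ℝ≥0∞} (hf : Measurable f) :
    ∫⁻ ω, g ω * f ((B t ω + κ * t) - (B s ω + κ * s)) ∂(driftRemovingMeasure κ P B T) =
      (∫⁻ ω, g ω ∂(driftRemovingMeasure κ P B T)) * ∫⁻ x, f x ∂gaussianReal 0 (t - s) := by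
  have h := lintegral_driftRemovingMeasure hB κ (hst.trans htT) le_rfl hg (f := fun _ => 1)
    measurable_const
  simp only [mul_one, lintegral_const, measure_univ] at h
  rw [lintegral_driftRemovingMeasure hB κ hst htT hg hf, h]

lemma isProbabilityMeasure_driftRemovingMeasure [IsProbabilityMeasure P]
    (hB : IsBrownianFor 𝓕 P B) (κ : ℝ) (T : ℝ≥0) :
    IsProbabilityMeasure (driftRemovingMeasure κ P B T) := by
  constructor
  have h := lintegral_driftRemovingMeasure hB κ (le_refl 0) (zero_le (a := T)) (g := fun _ => 1)
    measurable_const (f := fun _ => 1) measurable_const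
  simpa [expFactor] using h

/-- Girsanov's theorem for a constant drift. -/
lemma hasBrownianIncrements_driftRemovingMeasure [IsProbabilityMeasure P]
    (hB : IsBrownianFor 𝓕 P B) (κ : ℝ) (T : ℝ≥0) :
    HasBrownianIncrements 𝓕 (driftRemovingMeasure κ P B T) T (fun t ω => B t ω + κ * t) := by
  have hprob := isProbabilityMeasure_driftRemovingMeasure hB κ T
  have hmeas : ∀ s t : ℝ≥0, Measurable (fun ω => (B t ω + κ * t) - (B s ω + κ * s)) := fun s t =>
    ((hB.measurable' t).add_const _).sub ((hB.measurable' s).add_const _)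
  have hlaw : ∀ s t : ℝ≥0, s ≤ t → t ≤ T →
      HasLaw (fun ω => (B t ω + κ * t) - (B s ω + κ * s)) (gaussianReal 0 (t - s))
        (driftRemovingMeasure κ P B T) := by
    intro s t hst htT
    refine ⟨(hmeas s t).aemeasurable, ?_⟩
    ext S hS
    have h := lintegral_driftRemovingMeasure' hB κ hst htT (g := fun _ => 1) measurable_const
      (f := S.indicator 1) (measurable_one.indicator hS)
    simp only [one_mul, lintegral_const, measure_univ, lintegral_indicator_one hS] at h
    rw [Measure.map_apply (hmeas s t) hS, ← h,
      ← lintegral_indicator_one (hmeas s t hS)]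
    rfl
  refine ⟨fun t => (hB.measurable t).add_const _, hlaw, fun s t hst htT => ?_⟩
  rw [Indep_iff]
  rintro _ A ⟨S, hS, rfl⟩ hA
  have h := lintegral_driftRemovingMeasure' hB κ hst htT (g := A.indicator 1)
    (by refine Measurable.indicator ?_ hA; exact measurable_const) (f := S.indicator 1) (measurable_one.indicator hS)
  rw [lintegral_indicator_one (𝓕.le s A hA), lintegral_indicator_one hS,
    ← (hlaw s t hst htT).map_eq, Measure.map_apply (hmeas s t) hS] at h
  rw [mul_comm (driftRemovingMeasure κ P B T _) (driftRemovingMeasure κ P B T A), ← h, ← lintegral_indicator_one ((hmeas s t hS).inter (𝓕.le s A hA))]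
  refine lintegral_congr fun ω => ?_
  by_cases h1 : ω ∈ A <;> by_cases h2 : (B t ω + κ * t) - (B s ω + κ * s) ∈ S <;> simp [h1, h2]

end Girsanov

/-! ### Discounted gains of positive capital on a time grid -/

section DiscountedSums

/-- The uniform grid of mesh `1 / n`. -/
noncomputable def grid (n i : ℕ) : ℝ≥0 := i / n

/-- Discount factor over `i` periods of length `1 / n`. -/
noncomputable def disc (r : ℝ) (n i : ℕ) : ℝ := ((1 + r / n)⁻¹) ^ i

/-- Sum of the discounted increments of `f` over the first `j` periods of length `1 / n`. -/
noncomputable def discountedSum (r : ℝ) (n : ℕ) (f : ℝ≥0 → ℝ) (j : ℕ) : ℝ :=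
  ∑ i ∈ Finset.range j, disc r n i * (f (grid n (i + 1)) - f (grid n i))

lemma grid_zero (n : ℕ) : grid n 0 = 0 := by simp [grid]

lemma grid_mono (n : ℕ) : Monotone (grid n) := fun i j h => by
  unfold grid
  gcongr

lemma grid_self {n : ℕ} (hn : 0 < n) : grid n n = 1 := by
  have : (n : ℝ≥0) ≠ 0 := by exact_mod_cast hn.ne'
  simp [grid, this]

lemma grid_le_one {n j : ℕ} (hn : 0 < n) (hj : j ≤ n) : grid n j ≤ 1 :=
  (grid_mono n hj).trans (grid_self hn).le

lemma grid_succ_sub (n i : ℕ) : (grid n (i + 1) : ℝ) - grid n i = 1 / n := by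
  simp only [grid, NNReal.coe_div, NNReal.coe_natCast]
  push_cast
  ring

variable {r : ℝ}

lemma disc_zero (r : ℝ) (n : ℕ) : disc r n 0 = 1 := pow_zero _

lemma disc_pos (hr : 0 ≤ r) (n i : ℕ) : 0 < disc r n i := by
  unfold disc
  positivity

lemma disc_succ_mul (hr : 0 ≤ r) (n i : ℕ) : disc r n (i + 1) * (1 + r / n) = disc r n i := by
  have : (1 + r / n) ≠ 0 := by positivity
  rw [disc, disc, pow_succ, mul_assoc, inv_mul_cancel₀ this, mul_one]

lemma disc_succ_le (hr : 0 ≤ r) (n i : ℕ) : disc r n (i + 1) ≤ disc r n i := by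
  rw [← disc_succ_mul hr n i]
  have h1 := disc_pos hr n (i + 1)
  have : 0 ≤ r / n := by positivity
  nlinarith

lemma disc_le_one (hr : 0 ≤ r) (n i : ℕ) : disc r n i ≤ 1 := by
  induction i with
  | zero => rw [disc_zero]
  | succ i ih => exact (disc_succ_le hr n i).trans ih

lemma exp_neg_le_disc (hr : 0 ≤ r) {n i : ℕ} (hn : 0 < n) (hi : i ≤ n) :
    Real.exp (-r) ≤ disc r n i := by
  have hn' : (0 : ℝ) < n := by exact_mod_cast hn
  rw [disc, Real.exp_neg, inv_pow]
  refine inv_anti₀ (by positivity) ?_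
  calc (1 + r / n) ^ i ≤ (Real.exp (r / n)) ^ i := by
        gcongr
        rw [add_comm]
        exact Real.add_one_le_exp _
    _ = Real.exp (i * (r / n)) := (Real.exp_nat_mul _ _).symm
    _ ≤ Real.exp r := by
        apply Real.exp_le_exp.2
        have : (i : ℝ) ≤ n := by exact_mod_cast hi
        calc (i : ℝ) * (r / n) ≤ n * (r / n) := by gcongr
          _ = r := by field_simp

lemma discountedSum_succ (r : ℝ) (n : ℕ) (f : ℝ≥0 → ℝ) (j : ℕ) :
    discountedSum r n f (j + 1) =
      discountedSum r n f j + disc r n j * (f (grid n (j + 1)) - f (grid n j)) :=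
  Finset.sum_range_succ _ _

lemma discountedSum_zero (r : ℝ) (n : ℕ) (f : ℝ≥0 → ℝ) : discountedSum r n f 0 = 0 := rfl

lemma discountedSum_sub (r : ℝ) (n : ℕ) (f g : ℝ≥0 → ℝ) (j : ℕ) :
    discountedSum r n (fun t => f t - g t) j = discountedSum r n f j - discountedSum r n g j := by
  rw [discountedSum, discountedSum, discountedSum, ← Finset.sum_sub_distrib]
  exact Finset.sum_congr rfl fun i _ => by ring

/-- Summation by parts: the discount factors decrease from 1, so their total variation plus boundary
terms is at most 2. Thus uniformly close integrators have close discounted sums, whatever the mesh.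
-/
lemma abs_discountedSum_le (hr : 0 ≤ r) {n : ℕ} (hn : 0 < n) {f : ℝ≥0 → ℝ} {e : ℝ}
    (hf : ∀ t ≤ 1, |f t| ≤ e) {j : ℕ} (hj : j ≤ n) : |discountedSum r n f j| ≤ 2 * e := by
  have key : ∀ j ≤ n, |discountedSum r n f j - disc r n j * f (grid n j)| ≤
      e * (2 - disc r n j) := by
    intro j
    induction j with
    | zero =>
      intro _
      rw [discountedSum_zero, disc_zero, zero_sub, abs_neg, one_mul]
      have := hf (grid n 0) (grid_le_one hn (Nat.zero_le _))
      linarith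
    | succ j ih =>
      intro hj
      have h1 := ih (by omega)
      have h2 := hf (grid n (j + 1)) (grid_le_one hn hj)
      have h3 : 0 ≤ disc r n j - disc r n (j + 1) := sub_nonneg.2 (disc_succ_le hr n j)
      rw [discountedSum_succ]
      calc _ = |(discountedSum r n f j - disc r n j * f (grid n j)) +
              (disc r n j - disc r n (j + 1)) * f (grid n (j + 1))| := by congr 1; ring
        _ ≤ e * (2 - disc r n j) + (disc r n j - disc r n (j + 1)) * e := by
            refine (abs_add_le _ _).trans (add_le_add h1 ?_)
            rw [abs_mul, abs_of_nonneg h3]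
            exact mul_le_mul_of_nonneg_left h2 h3
        _ = _ := by ring
  have h1 := key j hj
  have h2 := hf (grid n j) (grid_le_one hn hj)
  have h3 := disc_pos hr n j
  calc |discountedSum r n f j| = |(discountedSum r n f j - disc r n j * f (grid n j)) +
        disc r n j * f (grid n j)| := by congr 1; ring
    _ ≤ e * (2 - disc r n j) + disc r n j * e := by
        refine (abs_add_le _ _).trans (add_le_add h1 ?_)
        rw [abs_mul, abs_of_pos h3]
        exact mul_le_mul_of_nonneg_left h2 h3.le
    _ = _ := by ring

/-- If positive capital `X` earns interest `r`, receives income `y`, pays for consumption `c` and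
is driven by gains `G`, then discounted gains are bounded below by discounted consumption. -/
lemma eventually_le_discountedSum (hr : 0 ≤ r) {y : ℝ} {X G c : ℝ≥0 → ℝ} {X₀ : ℝ}
    (hX : Continuous X) (hXpos : ∀ t, 0 < X t) (hc : ∀ t, 0 ≤ c t)
    (hci : IntegrableOn c (Set.Iic 1) timeMeasure)
    (heq : ∀ t ≤ 1, X t = X₀ + (∫ s in Set.Iic t, (r * X s + y - c s) ∂timeMeasure) + G t) :
    ∀ᶠ n : ℕ in atTop, ∀ j ≤ n, -X 0 - |y| - 1 +
      Real.exp (-r) * ∫ s in Set.Iic (grid n j), c s ∂timeMeasure ≤ discountedSum r n G j := by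
  obtain ⟨C, hC⟩ := (isCompact_Icc (a := (0 : ℝ≥0)) (b := 1)).exists_bound_of_continuousOn
    hX.continuousOn
  have huc : UniformContinuousOn X (Set.Icc 0 1) :=
    isCompact_Icc.uniformContinuousOn_of_continuous hX.continuousOn
  -- This tolerance for the oscillation of X on a cell makes the interest error r e at most 1/2 per
  -- unit of time; `ev2` allots the other 1/2 to the second-order discounting error.
  set e : ℝ := 1 / (2 * (r + 1)) with he
  have he0 : 0 < e := by positivity
  have hre : r * e ≤ 1 / 2 := by
    rw [he]
    field_simp
    linarith
  obtain ⟨d, hd, hdX⟩ := Metric.uniformContinuousOn_iff.1 huc e he0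
  have hC0 : 0 ≤ C := (norm_nonneg _).trans (hC 0 ⟨le_rfl, zero_le⟩)
  have ev1 : ∀ᶠ n : ℕ in atTop, 1 / (n : ℝ) < d :=
    (tendsto_one_div_atTop_nhds_zero_nat (𝕜 := ℝ)).eventually_lt_const hd
  have ev2 : ∀ᶠ n : ℕ in atTop, r ^ 2 * C * (1 / (n : ℝ)) < 1 / 2 := by
    have : Tendsto (fun n : ℕ => r ^ 2 * C * (1 / (n : ℝ))) atTop (𝓝 (r ^ 2 * C * 0)) :=
      (tendsto_one_div_atTop_nhds_zero_nat (𝕜 := ℝ)).const_mul _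
    rw [mul_zero] at this
    exact this.eventually_lt_const (by norm_num)
  filter_upwards [ev1, ev2, eventually_gt_atTop 0] with n hn1 hn2 hn0
  have hn' : (0 : ℝ) < n := by exact_mod_cast hn0
  set h : ℝ := 1 / n with hh
  have hhpos : 0 < h := by positivity
  have hXi : ∀ t, IntegrableOn X (Set.Iic t) timeMeasure := continuous_integrableOn_Iic hX
  -- Each cell loses at most h (1 + |y|), hence at most 1 + |y| in total over [0, 1]. The term with
  -- X is kept for the induction and dropped at the end by positivity.
  have key : ∀ j ≤ n, disc r n j * X (grid n j) - X 0 - j * h * (1 + |y|) +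
      Real.exp (-r) * ∫ s in Set.Iic (grid n j), c s ∂timeMeasure ≤ discountedSum r n G j := by
    intro j
    induction j with
    | zero =>
      intro _
      rw [grid_zero, disc_zero, discountedSum_zero]
      have : ∫ s in Set.Iic (0 : ℝ≥0), c s ∂timeMeasure = 0 := by
        apply setIntegral_measure_zero
        rw [timeMeasure_Iic]; rfl
      rw [this]
      simp
    | succ j ih =>
      intro hj
      have hIH := ih (by omega)
      set a := grid n j with ha
      set b := grid n (j + 1) with hb
      have hab : a ≤ b := grid_mono n j.le_succ
      have hb1 : b ≤ 1 := grid_le_one hn0 hj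
      have hbah : (b : ℝ) - a = h := grid_succ_sub n j
      have hcb : IntegrableOn c (Set.Iic b) timeMeasure := hci.mono_set (Set.Iic_subset_Iic.2 hb1)
      have hint : IntegrableOn (fun s => r * X s + y - c s) (Set.Iic b) timeMeasure :=
        (((hXi b).const_mul r).add (integrable_const y)).sub hcb
      have hIoc : Set.Ioc a b ⊆ Set.Iic b := Set.Ioc_subset_Iic_self
      have hG : G b - G a = X b - X a - ∫ s in Set.Ioc a b, (r * X s + y - c s) ∂timeMeasure := by
        rw [← setIntegral_Iic_sub _ hab hint, heq b hb1, heq a (hab.trans hb1)]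
        ring
      have hccell := setIntegral_Iic_sub c hab hcb
      have hfin : timeMeasure (Set.Ioc a b) ≠ ∞ := by
        rw [timeMeasure_Ioc]; exact ENNReal.ofReal_ne_top
      have hcellbound : ∫ s in Set.Ioc a b, (r * X s + y - c s) ∂timeMeasure ≤
          h * (r * (X b + e) + |y|) - ∫ s in Set.Ioc a b, c s ∂timeMeasure := by
        rw [← hbah, ← setIntegral_const_Ioc hab, ← integral_sub]
        · refine setIntegral_mono_on (hint.mono_set hIoc) ?_ measurableSet_Ioc ?_
          · exact (integrableOn_const (hs := hfin)).sub (hcb.mono_set hIoc)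
          · intro s hs
            have h1 : |X s - X b| < e := by
              have := hdX s ⟨zero_le, hs.2.trans hb1⟩ b ⟨zero_le, hb1⟩ (by
                rw [NNReal.dist_eq, abs_sub_comm, abs_of_nonneg]
                · have : (a : ℝ) < s := by exact_mod_cast hs.1
                  linarith
                · exact sub_nonneg.2 (by exact_mod_cast hs.2))
              rwa [Real.dist_eq] at this
            have h2 := (abs_lt.1 h1).2
            have h3 : r * X s ≤ r * (X b + e) := mul_le_mul_of_nonneg_left (by linarith) hr
            have h4 := le_abs_self y
            linarith
        · exact integrableOn_const (hs := hfin)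
        · exact hcb.mono_set hIoc
      set Ic := ∫ s in Set.Ioc a b, c s ∂timeMeasure with hIc
      have hIc0 : 0 ≤ Ic := setIntegral_nonneg measurableSet_Ioc fun s _ => hc s
      have hd1 := disc_succ_mul hr n j
      have hd2 := disc_le_one hr n j
      have hd3 := disc_pos hr n j
      have hd4 := disc_pos hr n (j + 1)
      have hd5 := disc_le_one hr n (j + 1)
      have hd6 := exp_neg_le_disc hr hn0 (show j ≤ n by omega)
      have hXb : X b ≤ C := (le_abs_self _).trans (hC b ⟨zero_le, hb1⟩)
      have hXb0 := hXpos b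
      have hrh : r / n = r * h := by rw [hh]; ring
      rw [hrh] at hd1
      rw [discountedSum_succ]
      have hstep : disc r n (j + 1) * X b - disc r n j * X a - h * (1 + |y|) +
          Real.exp (-r) * Ic ≤ disc r n j * (G b - G a) := by
        have e1 : disc r n j * (X b - X a - (h * (r * (X b + e) + |y|) - Ic)) ≤
            disc r n j * (G b - G a) := by
          refine mul_le_mul_of_nonneg_left ?_ hd3.le
          rw [hG]; linarith
        refine le_trans ?_ e1
        -- Discounting by 1 + rh and charging interest at the right endpoint cancel to first order,
        -- because (1 + rh)(1 - rh) = 1 - (rh)².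
        have e2 : disc r n j * X b - disc r n j * (r * h * X b) =
            disc r n (j + 1) * X b - disc r n (j + 1) * X b * (r * h) ^ 2 := by
          rw [← hd1]; ring
        have e3 : disc r n (j + 1) * X b * (r * h) ^ 2 ≤ C * (r * h) ^ 2 := by
          refine mul_le_mul_of_nonneg_right ?_ (sq_nonneg _)
          calc disc r n (j + 1) * X b ≤ 1 * X b := by gcongr
            _ ≤ C := by linarith
        have e4 : C * (r * h) ^ 2 ≤ h * (1 / 2) := by
          have : C * (r * h) ^ 2 = h * (r ^ 2 * C * h) := by ring
          rw [this]
          exact mul_le_mul_of_nonneg_left hn2.le hhpos.le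
        have e5 : disc r n j * (h * (r * e + |y|)) ≤ h * (1 / 2 + |y|) := by
          have h0 : 0 ≤ h * (r * e + |y|) := by positivity
          calc disc r n j * (h * (r * e + |y|)) ≤ 1 * (h * (r * e + |y|)) := by gcongr
            _ ≤ _ := by rw [one_mul]; gcongr
        have e6 : Real.exp (-r) * Ic ≤ disc r n j * Ic := by gcongr
        have e7 : disc r n j * (X b - X a - (h * (r * (X b + e) + |y|) - Ic)) =
            (disc r n j * X b - disc r n j * (r * h * X b)) - disc r n j * X a
              - disc r n j * (h * (r * e + |y|)) + disc r n j * Ic := by ring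
        rw [e7, e2]
        linarith
      have hsplit : ∫ s in Set.Iic b, c s ∂timeMeasure =
          (∫ s in Set.Iic a, c s ∂timeMeasure) + Ic := by linarith
      rw [hsplit, mul_add]
      push_cast
      linarith
  intro j hj
  refine le_trans ?_ (key j hj)
  have h1 : 0 ≤ disc r n j * X (grid n j) :=
    mul_nonneg (disc_pos hr n j).le (hXpos _).le
  have h2 : (j : ℝ) * h ≤ 1 := by
    have : (j : ℝ) ≤ n := by exact_mod_cast hj
    rw [hh, mul_one_div]
    exact (div_le_one hn').2 this
  have h3 : (j : ℝ) * h * (1 + |y|) ≤ 1 * (1 + |y|) := by gcongr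
  linarith

end DiscountedSums

/-- A Gaussian of variance v is √v times a standard one; the value of the standard fourth moment is
never needed. -/
lemma integral_pow_four_gaussianReal (v : ℝ≥0) :
    ∫ x, x ^ 4 ∂gaussianReal 0 v = (v : ℝ) ^ 2 * ∫ x, x ^ 4 ∂gaussianReal 0 1 := by
  have h := gaussianReal_map_const_mul (μ := 0) (v := 1) (Real.sqrt v)
  have e : NNReal.mk (Real.sqrt v ^ 2) (sq_nonneg _) * 1 = v := by
    apply NNReal.coe_injective
    rw [mul_one]
    exact Real.sq_sqrt v.2
  rw [mul_zero, e] at h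
  rw [← h, integral_map (by fun_prop) (by fun_prop), ← integral_const_mul]
  refine integral_congr_ae (ae_of_all _ fun x => ?_)
  have : Real.sqrt v ^ 2 = v := Real.sq_sqrt v.2
  simp only
  calc (Real.sqrt v * x) ^ 4 = (Real.sqrt v ^ 2) ^ 2 * x ^ 4 := by ring
    _ = _ := by rw [this]

/-! ### Elementary integrals as martingales, and a maximal-type estimate -/

section StoppedIntegrals

variable {Ω : Type*} {mΩ : MeasurableSpace Ω} {𝓕 : Filtration ℝ≥0 mΩ} {Q : Measure Ω}
  {X : ℝ≥0 → Ω → ℝ}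

namespace HasBrownianIncrements

variable {T : ℝ≥0}

lemma measurable (hX : HasBrownianIncrements 𝓕 Q T X) (t : ℝ≥0) : Measurable (X t) :=
  (hX.adapted t).mono (𝓕.le t) le_rfl

lemma memLp_sub (hX : HasBrownianIncrements 𝓕 Q T X) {s t : ℝ≥0} (hst : s ≤ t) (htT : t ≤ T)
    (p : ℝ≥0) : MemLp (fun ω => X t ω - X s ω) p Q := by
  have h := hX.law s t hst htT
  have h2 := memLp_id_gaussianReal (μ := 0) (v := t - s) p
  rw [← h.map_eq, memLp_map_measure_iff (by fun_prop) h.aemeasurable] at h2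
  exact h2

lemma integrable_sub (hX : HasBrownianIncrements 𝓕 Q T X) [IsFiniteMeasure Q] {s t : ℝ≥0}
    (hst : s ≤ t) (htT : t ≤ T) : Integrable (fun ω => X t ω - X s ω) Q :=
  memLp_one_iff_integrable.1 (by exact_mod_cast hX.memLp_sub hst htT 1)

lemma integrable_sub_pow_four (hX : HasBrownianIncrements 𝓕 Q T X) {s t : ℝ≥0}
    (hst : s ≤ t) (htT : t ≤ T) : Integrable (fun ω => (X t ω - X s ω) ^ 4) Q := by
  have h := (hX.memLp_sub hst htT 4).integrable_norm_pow (p := 4) (by norm_num)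
  refine h.congr (ae_of_all _ fun ω => ?_)
  simp only [Real.norm_eq_abs]
  exact Even.pow_abs (by decide) _

lemma integral_sub_pow_four (hX : HasBrownianIncrements 𝓕 Q T X) {s t : ℝ≥0}
    (hst : s ≤ t) (htT : t ≤ T) :
    ∫ ω, (X t ω - X s ω) ^ 4 ∂Q = ((t : ℝ) - s) ^ 2 * ∫ x, x ^ 4 ∂gaussianReal 0 1 := by
  have h := (hX.law s t hst htT).integral_comp (f := fun x => x ^ 4) (by fun_prop)
  rw [← NNReal.coe_sub hst, ← integral_pow_four_gaussianReal, ← h]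
  rfl

lemma integral_mul_sub_eq_zero (hX : HasBrownianIncrements 𝓕 Q T X) {s t : ℝ≥0} (hst : s ≤ t)
    (htT : t ≤ T) {g : Ω → ℝ} (hg : Measurable[𝓕 s] g) :
    ∫ ω, g ω * (X t ω - X s ω) ∂Q = 0 := by
  have hd : Measurable (fun ω => X t ω - X s ω) := (hX.measurable t).sub (hX.measurable s)
  have hind : IndepFun g (fun ω => X t ω - X s ω) Q := by
    rw [IndepFun_iff_Indep]
    exact indep_of_indep_of_le_left (hX.indep s t hst htT).symm hg.comap_le
  rw [hind.integral_fun_mul_eq_mul_integral (hg.mono (𝓕.le s) le_rfl).aestronglyMeasurable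
    hd.aestronglyMeasurable]
  have : ∫ ω, X t ω - X s ω ∂Q = 0 := by
    rw [(hX.law s t hst htT).integral_eq, integral_id_gaussianReal]
  rw [this, mul_zero]

end HasBrownianIncrements

/-- The point of `[s, t]` closest to `u`. -/
def clampTime (s t u : ℝ≥0) : ℝ≥0 := max s (min u t)

lemma clampTime_mono (s t : ℝ≥0) : Monotone (clampTime s t) := fun _ _ h =>
  max_le_max le_rfl (min_le_min h le_rfl)

lemma le_clampTime (s t u : ℝ≥0) : s ≤ clampTime s t u := le_max_left _ _

lemma clampTime_le {s t : ℝ≥0} (hst : s ≤ t) (u : ℝ≥0) : clampTime s t u ≤ t :=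
  max_le hst (min_le_right _ _)

namespace SimpleIntegrand

variable (V : SimpleIntegrand 𝓕)

/-- Clamping the partition to [s, t] makes every increment start at or after s, so a weight known at
time s can be absorbed into the coefficients. -/
lemma integral_sub_integral (X : ℝ≥0 → Ω → ℝ) {s t : ℝ≥0} (hst : s ≤ t) (ω : Ω) :
    V.integral X t ω - V.integral X s ω = ∑ i ∈ Finset.range V.n,
      V.ξ i ω * (X (clampTime s t (V.time (i + 1))) ω - X (clampTime s t (V.time i)) ω) := by
  have key : ∀ u, X (min u t) ω - X (min u s) ω = X (clampTime s t u) ω - X s ω := by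
    intro u
    unfold clampTime
    rcases le_total u s with h | h
    · rw [min_eq_left (h.trans hst), min_eq_left h, max_eq_left h]; ring
    · rw [min_eq_right h, max_eq_right (le_min h hst)]
  rw [integral, integral, ← Finset.sum_sub_distrib]
  refine Finset.sum_congr rfl fun i _ => ?_
  have h1 := key (V.time (i + 1))
  have h2 := key (V.time i)
  rw [← mul_sub]
  congr 1
  linarith

lemma exists_bound : ∃ C : ℝ, 0 ≤ C ∧ ∀ i ∈ Finset.range V.n, ∀ ω, |V.ξ i ω| ≤ C := by
  choose C hC using V.bdd
  refine ⟨∑ i ∈ Finset.range V.n, |C i|, by positivity, fun i hi ω => ?_⟩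
  exact ((hC i ω).trans (le_abs_self _)).trans
    (Finset.single_le_sum (f := fun i => |C i|) (fun j _ => abs_nonneg _) hi)

lemma measurable_ξ (i : ℕ) {t : ℝ≥0} (h : V.time i ≤ t) : Measurable[𝓕 t] (V.ξ i) :=
  (V.meas i).measurable.mono (𝓕.mono h) le_rfl

lemma measurable_integral (hX : ∀ t, Measurable[𝓕 t] (X t)) (t : ℝ≥0) :
    Measurable[𝓕 t] (V.integral X t) := by
  have : V.integral X t = fun ω => ∑ i ∈ Finset.range V.n,
      V.ξ i ω * (X (min (V.time (i + 1)) t) ω - X (min (V.time i) t) ω) := rfl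
  rw [this]
  refine Finset.measurable_fun_sum _ fun i _ => ?_
  rcases le_total (V.time i) t with h | h
  · have h1 : Measurable[𝓕 t] (X (min (V.time (i + 1)) t)) :=
      (hX _).mono (𝓕.mono (min_le_right _ _)) le_rfl
    have h2 : Measurable[𝓕 t] (X (min (V.time i) t)) :=
      (hX _).mono (𝓕.mono (min_le_right _ _)) le_rfl
    exact (V.measurable_ξ i h).mul (h1.sub h2)
  · simp only [min_eq_right h, min_eq_right (h.trans (V.time_mono i.le_succ)), sub_self, mul_zero]
    exact measurable_const

variable {V} {T : ℝ≥0}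

lemma integrable_mul_increment [IsFiniteMeasure Q] (hX : HasBrownianIncrements 𝓕 Q T X)
    {s t : ℝ≥0} (hst : s ≤ t) (htT : t ≤ T) {g : Ω → ℝ} (hg : Measurable g)
    (hgb : ∀ ω, |g ω| ≤ 1) {i : ℕ} :
    Integrable (fun ω => g ω * (V.ξ i ω *
      (X (clampTime s t (V.time (i + 1))) ω - X (clampTime s t (V.time i)) ω))) Q := by
  obtain ⟨C, hC⟩ := V.bdd i
  have h1 := hX.integrable_sub (clampTime_mono s t (V.time_mono i.le_succ))
    ((clampTime_le hst _).trans htT)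
  have h2 := h1.bdd_mul (c := C) ((V.meas i).measurable.mono (𝓕.le _) le_rfl).aestronglyMeasurable
    (ae_of_all _ fun ω => hC ω)
  exact h2.bdd_mul (c := 1) hg.aestronglyMeasurable (ae_of_all _ hgb)

lemma integrable_mul_integral_sub [IsFiniteMeasure Q] (hX : HasBrownianIncrements 𝓕 Q T X)
    {s t : ℝ≥0} (hst : s ≤ t) (htT : t ≤ T) {g : Ω → ℝ} (hg : Measurable g)
    (hgb : ∀ ω, |g ω| ≤ 1) :
    Integrable (fun ω => g ω * (V.integral X t ω - V.integral X s ω)) Q := by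
  simp only [V.integral_sub_integral X hst, Finset.mul_sum]
  exact integrable_finsetSum _ fun i _ => integrable_mul_increment hX hst htT hg hgb

/-- The martingale property of elementary stochastic integrals. -/
lemma integral_mul_integral_sub_eq_zero [IsFiniteMeasure Q] (hX : HasBrownianIncrements 𝓕 Q T X)
    {s t : ℝ≥0} (hst : s ≤ t) (htT : t ≤ T) {g : Ω → ℝ} (hg : Measurable[𝓕 s] g)
    (hgb : ∀ ω, |g ω| ≤ 1) :
    ∫ ω, g ω * (V.integral X t ω - V.integral X s ω) ∂Q = 0 := by
  simp only [V.integral_sub_integral X hst, Finset.mul_sum]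
  rw [integral_finsetSum _ fun i _ =>
    integrable_mul_increment hX hst htT (hg.mono (𝓕.le s) le_rfl) hgb]
  refine Finset.sum_eq_zero fun i _ => ?_
  have hmono := clampTime_mono s t (V.time_mono i.le_succ)
  rcases le_total (V.time i) t with h | h
  · have h1 : V.time i ≤ clampTime s t (V.time i) := by
      rw [clampTime, min_eq_left h]; exact le_max_right _ _
    have h2 := hX.integral_mul_sub_eq_zero hmono ((clampTime_le hst _).trans htT)
      (g := fun ω => g ω * V.ξ i ω)
      ((hg.mono (𝓕.mono (le_clampTime _ _ _)) le_rfl).mul (V.measurable_ξ i h1))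
    simpa only [mul_assoc] using h2
  · have e : clampTime s t (V.time (i + 1)) = clampTime s t (V.time i) := by
      rw [clampTime, clampTime, min_eq_right h, min_eq_right (h.trans (V.time_mono i.le_succ))]
    simp [e]

/-- Cauchy-Schwarz applied twice bounds the fourth power of the sum by n³ times the sum of fourth
powers. The order (t - s)² is the point: on a grid of mesh 1/n these moments add up to only O(1/n).
-/
lemma exists_fourth_moment_bound [IsFiniteMeasure Q] (hX : HasBrownianIncrements 𝓕 Q T X) :
    ∃ K : ℝ, 0 ≤ K ∧ ∀ s t : ℝ≥0, s ≤ t → t ≤ T →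
      Integrable (fun ω => (V.integral X t ω - V.integral X s ω) ^ 4) Q ∧
      ∫ ω, (V.integral X t ω - V.integral X s ω) ^ 4 ∂Q ≤ K * ((t : ℝ) - s) ^ 2 := by
  obtain ⟨C, hC0, hC⟩ := V.exists_bound
  have hm4 : 0 ≤ ∫ x, x ^ 4 ∂gaussianReal 0 1 := integral_nonneg fun x => by positivity
  refine ⟨(V.n : ℝ) ^ 3 * ∑ i ∈ Finset.range V.n, C ^ 4 * ∫ x, x ^ 4 ∂gaussianReal 0 1,
    by positivity, fun s t hst htT => ?_⟩
  set Δ : ℕ → Ω → ℝ := fun i ω =>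
    X (clampTime s t (V.time (i + 1))) ω - X (clampTime s t (V.time i)) ω with hΔ
  have hmono : ∀ i, clampTime s t (V.time i) ≤ clampTime s t (V.time (i + 1)) := fun i =>
    clampTime_mono s t (V.time_mono i.le_succ)
  have hΔi : ∀ i, Integrable (fun ω => Δ i ω ^ 4) Q := fun i =>
    hX.integrable_sub_pow_four (hmono i) ((clampTime_le hst _).trans htT)
  have hb : ∀ ω, (V.integral X t ω - V.integral X s ω) ^ 4 ≤
      (V.n : ℝ) ^ 3 * ∑ i ∈ Finset.range V.n, C ^ 4 * Δ i ω ^ 4 := by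
    intro ω
    rw [V.integral_sub_integral X hst]
    have h1 := sq_sum_le_card_mul_sum_sq (s := Finset.range V.n)
      (f := fun i => V.ξ i ω * Δ i ω)
    have h2 := sq_sum_le_card_mul_sum_sq (s := Finset.range V.n)
      (f := fun i => (V.ξ i ω * Δ i ω) ^ 2)
    rw [Finset.card_range] at h1 h2
    calc (∑ i ∈ Finset.range V.n, V.ξ i ω * Δ i ω) ^ 4
        = ((∑ i ∈ Finset.range V.n, V.ξ i ω * Δ i ω) ^ 2) ^ 2 := by ring
      _ ≤ ((V.n : ℝ) * ∑ i ∈ Finset.range V.n, (V.ξ i ω * Δ i ω) ^ 2) ^ 2 := by gcongr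
      _ = (V.n : ℝ) ^ 2 * (∑ i ∈ Finset.range V.n, (V.ξ i ω * Δ i ω) ^ 2) ^ 2 := by ring
      _ ≤ (V.n : ℝ) ^ 2 *
          ((V.n : ℝ) * ∑ i ∈ Finset.range V.n, ((V.ξ i ω * Δ i ω) ^ 2) ^ 2) := by gcongr
      _ = (V.n : ℝ) ^ 3 * ∑ i ∈ Finset.range V.n, ((V.ξ i ω * Δ i ω) ^ 2) ^ 2 := by ring
      _ ≤ _ := by
          refine mul_le_mul_of_nonneg_left (Finset.sum_le_sum fun i hi => ?_) (by positivity)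
          have h3 : V.ξ i ω ^ 4 ≤ C ^ 4 := by
            rw [← Even.pow_abs (by decide : Even 4)]
            exact pow_le_pow_left₀ (abs_nonneg _) (hC i hi ω) 4
          calc ((V.ξ i ω * Δ i ω) ^ 2) ^ 2 = V.ξ i ω ^ 4 * Δ i ω ^ 4 := by ring
            _ ≤ _ := by gcongr
  have hmeas : Measurable (fun ω => (V.integral X t ω - V.integral X s ω) ^ 4) :=
    (((V.measurable_integral hX.adapted t).mono (𝓕.le t) le_rfl).sub
      ((V.measurable_integral hX.adapted s).mono (𝓕.le s) le_rfl)).pow_const 4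
  have hRi : Integrable (fun ω => (V.n : ℝ) ^ 3 *
      ∑ i ∈ Finset.range V.n, C ^ 4 * Δ i ω ^ 4) Q :=
    (integrable_finsetSum _ fun i _ => (hΔi i).const_mul _).const_mul _
  have hLi : Integrable (fun ω => (V.integral X t ω - V.integral X s ω) ^ 4) Q := by
    refine hRi.mono' hmeas.aestronglyMeasurable (ae_of_all _ fun ω => ?_)
    rw [Real.norm_of_nonneg (by positivity)]
    exact hb ω
  refine ⟨hLi, (integral_mono hLi hRi hb).trans ?_⟩
  rw [integral_const_mul, integral_finsetSum _ fun i _ => (hΔi i).const_mul _, mul_assoc,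
    Finset.sum_mul]
  refine mul_le_mul_of_nonneg_left (Finset.sum_le_sum fun i _ => ?_) (by positivity)
  rw [integral_const_mul, mul_assoc]
  refine mul_le_mul_of_nonneg_left ?_ (by positivity)
  rw [hX.integral_sub_pow_four (hmono i) ((clampTime_le hst _).trans htT), mul_comm]
  refine mul_le_mul_of_nonneg_left ?_ hm4
  have h1 : (s : ℝ) ≤ clampTime s t (V.time i) := by exact_mod_cast le_clampTime _ _ _
  have h2 : (clampTime s t (V.time (i + 1)) : ℝ) ≤ t := by exact_mod_cast clampTime_le hst _
  have h3 : (clampTime s t (V.time i) : ℝ) ≤ clampTime s t (V.time (i + 1)) := by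
    exact_mod_cast hmono i
  exact pow_le_pow_left₀ (by linarith) (by linarith) 2

end SimpleIntegrand

/-- A discrete transform stopped at the first time it falls to `-b` cannot end far below `-b`. -/
lemma stopped_sum_bounds {d x D θ : ℕ → ℝ} {b : ℝ} (hb : 0 < b) (hd : ∀ i, 0 < d i)
    (hd1 : ∀ i, d i ≤ 1) (hD0 : D 0 = 0) (hD : ∀ i, D (i + 1) = D i + d i * x i)
    (hθ1 : ∀ i, (∀ l ≤ i, -b < D l) → θ i = 1) (hθ0 : ∀ i, ¬(∀ l ≤ i, -b < D l) → θ i = 0)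
    (j : ℕ) :
    -b - 1 - ∑ i ∈ Finset.range j, x i ^ 4 ≤ ∑ i ∈ Finset.range j, θ i * (d i * x i) ∧
    ((∀ l < j, -b < D l) → ∑ i ∈ Finset.range j, θ i * (d i * x i) = D j) := by
  induction j with
  | zero => simpa [hD0] using by linarith
  | succ j ih =>
    rw [Finset.sum_range_succ, Finset.sum_range_succ]
    by_cases h : ∀ l ≤ j, -b < D l
    · have hS := ih.2 fun l hl => h l hl.le
      rw [hθ1 j h, one_mul, hS, ← hD]
      refine ⟨?_, fun _ => rfl⟩
      have h1 := h j le_rfl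
      have h2 : 0 ≤ ∑ i ∈ Finset.range j, x i ^ 4 := by positivity
      have h3 : |d j * x j| ≤ 1 + x j ^ 4 := by
        rw [abs_mul, abs_of_pos (hd j)]
        have h4 : d j * |x j| ≤ 1 * |x j| := mul_le_mul_of_nonneg_right (hd1 j) (abs_nonneg _)
        -- Overshoot of the step that crosses -b: the constant 1 is affordable, and the fourth power
        -- vanishes in the mean as the mesh shrinks.
        have h5 : |x j| ≤ 1 + x j ^ 4 := by
          rcases le_total |x j| 1 with h6 | h6
          · have : 0 ≤ x j ^ 4 := by positivity
            linarith
          · have : |x j| ^ 1 ≤ |x j| ^ 4 := pow_le_pow_right₀ h6 (by norm_num)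
            rw [Even.pow_abs (by decide : Even 4), pow_one] at this
            linarith
        linarith
      have h7 := (abs_le.1 h3).1
      rw [hD]
      linarith
    · rw [hθ0 j h, zero_mul, add_zero]
      refine ⟨?_, fun hcon => absurd (fun l hl => hcon l (Nat.lt_succ_of_le hl)) h⟩
      have : 0 ≤ x j ^ 4 := by positivity
      linarith [ih.1]

/-- Discounted elementary integrals that stay above `-b` reach the level `a` with probability at
most of order `b / a`. -/
lemma measure_stays_above_and_reaches_le [IsProbabilityMeasure Q]
    (hX : HasBrownianIncrements 𝓕 Q 1 X) (V : SimpleIntegrand 𝓕) {r : ℝ} (hr : 0 ≤ r) :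
    ∃ K : ℝ, ∀ (a b : ℝ) (n : ℕ), 0 < a → 0 < b → 0 < n →
      Q {ω | (∀ l < n, -b < discountedSum r n (fun t => V.integral X t ω) l) ∧
        a ≤ discountedSum r n (fun t => V.integral X t ω) n} ≤
      ENNReal.ofReal ((b + 1 + K / n) / a) := by
  classical
  obtain ⟨K, hK0, hK⟩ := SimpleIntegrand.exists_fourth_moment_bound (V := V) hX
  refine ⟨K, fun a b n ha hb hn => ?_⟩
  have hn' : (0 : ℝ) < n := by exact_mod_cast hn
  set D : ℕ → Ω → ℝ := fun l ω => discountedSum r n (fun t => V.integral X t ω) l with hD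
  set x : ℕ → Ω → ℝ := fun i ω =>
    V.integral X (grid n (i + 1)) ω - V.integral X (grid n i) ω with hx
  -- Whether the process is still running is known at the left end of the cell, so each stopped
  -- increment has mean zero.
  set θ : ℕ → Ω → ℝ := fun i ω => if ∀ l ≤ i, -b < D l ω then 1 else 0 with hθ
  have hDmeas : ∀ l, Measurable[𝓕 (grid n l)] (D l) := by
    intro l
    refine Finset.measurable_fun_sum _ fun i hi => ?_
    have h1 : Measurable[𝓕 (grid n l)] (V.integral X (grid n (i + 1))) :=
      (V.measurable_integral hX.adapted _).mono
        (𝓕.mono (grid_mono n (Finset.mem_range.1 hi))) le_rfl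
    have h2 : Measurable[𝓕 (grid n l)] (V.integral X (grid n i)) :=
      (V.measurable_integral hX.adapted _).mono
        (𝓕.mono (grid_mono n (Finset.mem_range.1 hi).le)) le_rfl
    exact (h1.sub h2).const_mul _
  have hθmeas : ∀ i, Measurable[𝓕 (grid n i)] (θ i) := by
    intro i
    have hset : MeasurableSet[𝓕 (grid n i)] {ω | ∀ l ≤ i, -b < D l ω} := by
      have : {ω | ∀ l ≤ i, -b < D l ω} = ⋂ l ∈ Finset.range (i + 1), {ω | -b < D l ω} := by
        ext ω
        simp
      rw [this]
      refine Finset.measurableSet_biInter _ fun l hl => ?_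
      have h1 : Measurable[𝓕 (grid n i)] (D l) := (hDmeas l).mono
        (𝓕.mono (grid_mono n (Nat.lt_succ_iff.1 (Finset.mem_range.1 hl)))) le_rfl
      exact h1 measurableSet_Ioi
    exact Measurable.ite hset measurable_const measurable_const
  have hθb : ∀ i ω, |θ i ω| ≤ 1 := by
    intro i ω
    simp only [hθ]
    split_ifs <;> simp
  have hgi : ∀ i, grid n i ≤ grid n (i + 1) := fun i => grid_mono n i.le_succ
  have hg1 : ∀ i ∈ Finset.range n, grid n (i + 1) ≤ 1 := fun i hi =>
    grid_le_one hn (Finset.mem_range.1 hi)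
  set S : Ω → ℝ := fun ω => ∑ i ∈ Finset.range n, θ i ω * (disc r n i * x i ω) with hS
  have hSterm : ∀ i ω, θ i ω * (disc r n i * x i ω) = disc r n i * (θ i ω * x i ω) :=
    fun i ω => by ring
  have hSi : ∀ i ∈ Finset.range n, Integrable (fun ω => θ i ω * (disc r n i * x i ω)) Q := by
    intro i hi
    simp only [hSterm]
    exact (SimpleIntegrand.integrable_mul_integral_sub hX (hgi i) (hg1 i hi)
      ((hθmeas i).mono (𝓕.le _) le_rfl) (hθb i)).const_mul _
  have hSint : Integrable S Q := integrable_finsetSum _ hSi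
  have hS0 : ∫ ω, S ω ∂Q = 0 := by
    rw [integral_finsetSum _ hSi]
    refine Finset.sum_eq_zero fun i hi => ?_
    simp only [hSterm]
    rw [integral_const_mul, SimpleIntegrand.integral_mul_integral_sub_eq_zero hX (hgi i)
      (hg1 i hi) (hθmeas i) (hθb i), mul_zero]
  have hRi : ∀ i ∈ Finset.range n, Integrable (fun ω => x i ω ^ 4) Q := fun i hi =>
    (hK _ _ (hgi i) (hg1 i hi)).1
  have hRint : Integrable (fun ω => ∑ i ∈ Finset.range n, x i ω ^ 4) Q :=
    integrable_finsetSum _ hRi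
  have hR : ∫ ω, ∑ i ∈ Finset.range n, x i ω ^ 4 ∂Q ≤ K / n := by
    rw [integral_finsetSum _ hRi]
    calc ∑ i ∈ Finset.range n, ∫ ω, x i ω ^ 4 ∂Q
        ≤ ∑ i ∈ Finset.range n, K * (1 / n) ^ 2 := by
          refine Finset.sum_le_sum fun i hi => ?_
          rw [← grid_succ_sub n i]
          exact (hK _ _ (hgi i) (hg1 i hi)).2
      _ = K / n := by
          rw [Finset.sum_const, Finset.card_range, nsmul_eq_mul]
          field_simp
  have hbounds : ∀ ω, _ := fun ω => stopped_sum_bounds (d := disc r n) (x := fun i => x i ω)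
    (D := fun l => D l ω) (θ := fun i => θ i ω) hb (disc_pos hr n) (disc_le_one hr n) rfl
    (fun i => discountedSum_succ r n _ i) (fun i h => if_pos h) (fun i h => if_neg h) n
  -- The stopped sum has mean zero and is made nonnegative by adding the level and the overshoot, so
  -- Markov's inequality applies. On the event in question nothing was stopped before the last step,
  -- and S is the full discounted sum.
  set f : Ω → ℝ := fun ω => S ω + (b + 1) + ∑ i ∈ Finset.range n, x i ω ^ 4 with hf
  have hf0 : ∀ ω, 0 ≤ f ω := fun ω => by
    have := (hbounds ω).1
    simp only [hf, hS]
    linarith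
  have hfint : Integrable f Q := (hSint.add (integrable_const _)).add hRint
  have hfI : ∫ ω, f ω ∂Q ≤ b + 1 + K / n := by
    have h1 : ∫ ω, f ω ∂Q = (∫ ω, S ω ∂Q) + (∫ _, (b + 1) ∂Q) +
        ∫ ω, ∑ i ∈ Finset.range n, x i ω ^ 4 ∂Q := by
      rw [← integral_add hSint (integrable_const _)]
      exact integral_add (hSint.add (integrable_const _)) hRint
    rw [h1, hS0]
    simp only [integral_const, probReal_univ, one_smul]
    linarith
  have hmarkov := mul_meas_ge_le_integral_of_nonneg (ae_of_all _ hf0) hfint a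
  have hsub : {ω | (∀ l < n, -b < D l ω) ∧ a ≤ D n ω} ⊆ {ω | a ≤ f ω} := by
    intro ω hω
    have h1 := (hbounds ω).2 hω.1
    have h2 : a ≤ D n ω := hω.2
    have h3 : 0 ≤ ∑ i ∈ Finset.range n, x i ω ^ 4 := by positivity
    change a ≤ S ω + (b + 1) + ∑ i ∈ Finset.range n, x i ω ^ 4
    have h4 : S ω = D n ω := h1
    linarith
  refine (measure_mono hsub).trans ?_
  rw [← ofReal_measureReal]
  refine ENNReal.ofReal_le_ofReal ?_
  rw [le_div_iff₀ ha, mul_comm]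
  exact hmarkov.trans hfI

end StoppedIntegrals

/-! ### The budget bound under the drift-removing measure -/

section Budget

variable {Ω : Type*} {mΩ : MeasurableSpace Ω} {𝓕 : Filtration ℝ≥0 mΩ} {P : Measure Ω}
  {B : ℝ≥0 → Ω → ℝ}

lemma driftRemovingMeasure_absolutelyContinuous (κ : ℝ) (T : ℝ≥0) :
    driftRemovingMeasure κ P B T ≪ P :=
  withDensity_absolutelyContinuous _ _

lemma tendsto_driftRemovingMeasure [IsProbabilityMeasure P] (hB : IsBrownianFor 𝓕 P B) (κ : ℝ)
    (T : ℝ≥0) {s : ℕ → Set Ω} (hs : Tendsto (fun k => P (s k)) atTop (𝓝 0)) :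
    Tendsto (fun k => driftRemovingMeasure κ P B T (s k)) atTop (𝓝 0) := by
  have hprob := isProbabilityMeasure_driftRemovingMeasure hB κ T
  have hfin : ∫⁻ ω, expFactor κ B 0 T ω ∂P ≠ ∞ := by
    have : ∫⁻ ω, expFactor κ B 0 T ω ∂P = driftRemovingMeasure κ P B T Set.univ := by
      rw [driftRemovingMeasure, withDensity_apply _ MeasurableSet.univ, setLIntegral_univ]
    rw [this]
    exact measure_ne_top _ _
  have := tendsto_setLIntegral_zero hfin hs
  refine this.congr fun k => ?_
  rw [driftRemovingMeasure, withDensity_apply']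

/-- The density is positive and finite, so P in turn has an integrable density with respect to the
new measure; the claim is absolute continuity of its integral. -/
lemma exists_le_of_driftRemovingMeasure_lt [IsProbabilityMeasure P] (hB : IsBrownianFor 𝓕 P B)
    (κ : ℝ) (T : ℝ≥0) {e : ℝ≥0∞} (he : e ≠ 0) :
    ∃ d > 0, ∀ s, driftRemovingMeasure κ P B T s < d → P s < e := by
  have hprob := isProbabilityMeasure_driftRemovingMeasure hB κ T
  have hm : Measurable (expFactor κ B 0 T) :=
    (measurable_expFactor hB κ zero_le).mono (𝓕.le T) le_rfl
  have hinv : (driftRemovingMeasure κ P B T).withDensity (expFactor κ B 0 T)⁻¹ = P := by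
    refine withDensity_inv_same hm (ae_of_all _ fun ω => ?_) (ae_of_all _ fun ω => ?_)
    · rw [expFactor, ne_eq, ENNReal.ofReal_eq_zero, not_le]; positivity
    · exact ENNReal.ofReal_ne_top
  have hfin : ∫⁻ ω, (expFactor κ B 0 T)⁻¹ ω ∂(driftRemovingMeasure κ P B T) ≠ ∞ := by
    rw [← setLIntegral_univ, ← withDensity_apply _ MeasurableSet.univ, hinv]
    exact measure_ne_top _ _
  obtain ⟨d, hd, h⟩ := exists_pos_setLIntegral_lt_of_measure_lt hfin he
  refine ⟨d, hd, fun s hs => ?_⟩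
  have := h s hs
  rwa [← withDensity_apply', hinv] at this

lemma SimpleIntegrand.integrableOn_process (V : SimpleIntegrand 𝓕) (t : ℝ≥0) (ω : Ω) :
    IntegrableOn (fun s => V.process s ω) (Set.Iic t) timeMeasure := by
  refine integrable_finsetSum _ fun i _ => ?_
  exact (integrable_const _).indicator measurableSet_Ioc

lemma SimpleIntegrand.setIntegral_process (V : SimpleIntegrand 𝓕) (t : ℝ≥0) (ω : Ω) :
    ∫ s in Set.Iic t, V.process s ω ∂timeMeasure = ∑ i ∈ Finset.range V.n,
      V.ξ i ω * ((min (V.time (i + 1)) t : ℝ≥0) - (min (V.time i) t : ℝ≥0) : ℝ) := by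
  simp only [process]
  rw [integral_finsetSum _ fun i _ => (integrable_const _).indicator measurableSet_Ioc]
  refine Finset.sum_congr rfl fun i _ => ?_
  rw [integral_indicator measurableSet_Ioc, Measure.restrict_restrict measurableSet_Ioc,
    Set.Ioc_inter_Iic, setIntegral_const, measureReal_def, timeMeasure_Ioc, smul_eq_mul, mul_comm]
  congr 1
  rcases le_total (V.time i) t with h | h
  · rw [min_eq_left h, ENNReal.toReal_ofReal]
    exact sub_nonneg.2 (by exact_mod_cast le_min (V.time_mono i.le_succ) h)
  · rw [min_eq_right h, min_eq_right (h.trans (V.time_mono i.le_succ)), sub_self,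
      ENNReal.ofReal_of_nonpos (sub_nonpos.2 (by exact_mod_cast h)), ENNReal.toReal_zero]

lemma SimpleIntegrand.integral_add_drift (V : SimpleIntegrand 𝓕) (κ : ℝ) (B : ℝ≥0 → Ω → ℝ)
    (t : ℝ≥0) (ω : Ω) : V.integral (fun t ω => B t ω + κ * t) t ω =
      V.integral B t ω + κ * ∫ s in Set.Iic t, V.process s ω ∂timeMeasure := by
  rw [V.setIntegral_process, integral, integral, Finset.mul_sum, ← Finset.sum_add_distrib]
  exact Finset.sum_congr rfl fun i _ => by ring

lemma SimpleIntegrand.integral_zero (V : SimpleIntegrand 𝓕) (X : ℝ≥0 → Ω → ℝ) (ω : Ω) :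
    V.integral X 0 ω = 0 := by
  simp [integral]

/-- Integrate |f| ≤ e + f²/e over an interval of length one. -/
lemma integrableOn_and_abs_setIntegral_le {f : ℝ≥0 → ℝ} (hf : Measurable f) {e : ℝ} (he : 0 < e)
    (h : ∫⁻ t in Set.Iic 1, ENNReal.ofReal (f t ^ 2) ∂timeMeasure < ENNReal.ofReal (e ^ 2)) :
    IntegrableOn f (Set.Iic 1) timeMeasure ∧
      ∀ t ≤ 1, |∫ s in Set.Iic t, f s ∂timeMeasure| ≤ 2 * e := by
  have hsq : IntegrableOn (fun t => f t ^ 2) (Set.Iic 1) timeMeasure :=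
    (lintegral_ofReal_ne_top_iff_integrable (hf.pow_const 2).aestronglyMeasurable
      (ae_of_all _ fun t => sq_nonneg _)).1 (h.trans_le le_top).ne
  have hint2 : ∫ t in Set.Iic 1, f t ^ 2 ∂timeMeasure ≤ e ^ 2 := by
    rw [integral_eq_lintegral_of_nonneg_ae (ae_of_all _ fun t => sq_nonneg _)
      (hf.pow_const 2).aestronglyMeasurable]
    exact ENNReal.toReal_le_of_le_ofReal (by positivity) h.le
  have hbd : ∀ t, |f t| ≤ e + f t ^ 2 / e := by
    intro t
    rcases le_total |f t| e with h1 | h1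
    · have : 0 ≤ f t ^ 2 / e := by positivity
      linarith
    · have : |f t| ≤ f t ^ 2 / e := by
        rw [le_div_iff₀ he, ← sq_abs, sq]
        exact mul_le_mul_of_nonneg_left h1 (abs_nonneg _)
      linarith
  have hdom : IntegrableOn (fun t => e + f t ^ 2 / e) (Set.Iic 1) timeMeasure :=
    (integrable_const e).add (hsq.div_const e)
  have hfi : IntegrableOn f (Set.Iic 1) timeMeasure :=
    hdom.mono' hf.aestronglyMeasurable (ae_of_all _ hbd)
  refine ⟨hfi, fun t ht => ?_⟩
  calc |∫ s in Set.Iic t, f s ∂timeMeasure| ≤ ∫ s in Set.Iic t, |f s| ∂timeMeasure :=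
        abs_integral_le_integral_abs
    _ ≤ ∫ s in Set.Iic 1, |f s| ∂timeMeasure :=
        setIntegral_mono_set hfi.abs (ae_of_all _ fun _ => abs_nonneg _)
          (Set.Iic_subset_Iic.2 ht).eventuallyLE
    _ ≤ ∫ s in Set.Iic 1, (e + f s ^ 2 / e) ∂timeMeasure :=
        integral_mono hfi.abs hdom hbd
    _ ≤ 2 * e := by
        have h1 : ∫ s in Set.Iic 1, (e + f s ^ 2 / e) ∂timeMeasure =
            e + (∫ s in Set.Iic 1, f s ^ 2 ∂timeMeasure) / e := by
          rw [integral_add (integrable_const e) (hsq.div_const e), integral_div, setIntegral_const,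
            measureReal_def, timeMeasure_Iic]
          simp
        rw [h1]
        have : (∫ s in Set.Iic 1, f s ^ 2 ∂timeMeasure) / e ≤ e := by
          rw [div_le_iff₀ he, ← sq]
          exact hint2
        linarith

lemma IsItoIntegral.ae_integrableOn {A M : ℝ≥0 → Ω → ℝ} (h : IsItoIntegral 𝓕 P B A M) :
    ∀ᵐ ω ∂P, IntegrableOn (fun t => A t ω) (Set.Iic 1) timeMeasure := by
  obtain ⟨V, hV⟩ := h.approx
  have hlim := (hV 1).1 1 one_pos
  -- Almost every state has some k for which the simple process is within distance one of A in L²[0,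
  -- 1]; integrability of A follows from that of the simple process.
  have hnull : P (⋂ k, {ω | 1 ≤ ∫⁻ t in Set.Iic 1,
      ENNReal.ofReal (((V k).process t ω - A t ω) ^ 2) ∂timeMeasure}) = 0 := by
    refine le_antisymm (ge_of_tendsto' hlim fun k => ?_) zero_le
    exact measure_mono (Set.iInter_subset _ k)
  filter_upwards [measure_eq_zero_iff_ae_notMem.1 hnull] with ω hω
  simp only [Set.mem_iInter, not_forall] at hω
  obtain ⟨k, hk⟩ := hω
  have hk' : ∫⁻ t in Set.Iic 1, ENNReal.ofReal (((V k).process t ω - A t ω) ^ 2) ∂timeMeasure < 1 :=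
    not_le.1 hk
  have hm : Measurable (fun t => (V k).process t ω - A t ω) := by
    refine Measurable.sub ?_ (measurable_section_of_prog h.integrand_prog ω)
    exact Finset.measurable_fun_sum _ fun i _ => measurable_const.indicator measurableSet_Ioc
  have h1 := (integrableOn_and_abs_setIntegral_le hm one_pos (by simpa using hk')).1
  have h2 := ((V k).integrableOn_process 1 ω).sub h1
  refine h2.congr (ae_of_all _ fun t => ?_)
  simp

/-- The gains process is approximated by elementary integrals against the Brownian motion with
drift. -/
lemma IsItoIntegral.exists_approx_add_drift {A M : ℝ≥0 → Ω → ℝ} (h : IsItoIntegral 𝓕 P B A M)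
    (κ : ℝ) : ∃ V : ℕ → SimpleIntegrand 𝓕, ∀ c : ℝ, 0 < c →
      Tendsto (fun k => P {ω | ∃ t ≤ 1, c ≤ |(V k).integral (fun t ω => B t ω + κ * t) t ω -
        (M t ω + κ * ∫ s in Set.Iic t, A s ω ∂timeMeasure)|}) atTop (𝓝 0) := by
  obtain ⟨V, hV⟩ := h.approx
  refine ⟨V, fun c hc => ?_⟩
  -- Chosen so that the drift part of the error, at most |κ| · 2e, stays below c / 2.
  set e : ℝ := c / (8 * (|κ| + 1)) with he
  have he0 : 0 < e := by positivity
  have hκe : |κ| * (2 * e) < c / 2 := by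
    have h1 : (|κ| + 1) * e = c / 8 := by rw [he]; field_simp
    nlinarith [abs_nonneg κ]
  have l1 := (hV 1).1 (ENNReal.ofReal (e ^ 2)) (by rw [ENNReal.ofReal_pos]; positivity)
  have l2 := (hV 1).2 (c / 2) (by positivity)
  have l3 := l1.add l2
  rw [add_zero] at l3
  refine tendsto_of_tendsto_of_tendsto_of_le_of_le tendsto_const_nhds l3 (fun _ => zero_le)
    fun k => ?_
  refine le_trans (measure_mono ?_) (measure_union_le _ _)
  rintro ω ⟨t, ht, hct⟩
  by_contra hcon
  simp only [Set.mem_union, not_or] at hcon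
  have h1 : ∫⁻ t in Set.Iic 1, ENNReal.ofReal (((V k).process t ω - A t ω) ^ 2) ∂timeMeasure <
      ENNReal.ofReal (e ^ 2) := not_le.1 hcon.1
  have h2 : |(V k).integral B t ω - M t ω| < c / 2 := by
    by_contra h3
    exact hcon.2 ⟨t, ht, not_lt.1 h3⟩
  have hm : Measurable (fun t => (V k).process t ω - A t ω) := by
    refine Measurable.sub ?_ (measurable_section_of_prog h.integrand_prog ω)
    exact Finset.measurable_fun_sum _ fun i _ => measurable_const.indicator measurableSet_Ioc
  obtain ⟨hi, hb⟩ := integrableOn_and_abs_setIntegral_le hm he0 h1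
  have hVi := (V k).integrableOn_process t ω
  have hit : IntegrableOn (fun s => (V k).process s ω - A s ω) (Set.Iic t) timeMeasure :=
    hi.mono_set (Set.Iic_subset_Iic.2 ht)
  have hAi : ∫ s in Set.Iic t, A s ω ∂timeMeasure =
      (∫ s in Set.Iic t, (V k).process s ω ∂timeMeasure) -
        ∫ s in Set.Iic t, ((V k).process s ω - A s ω) ∂timeMeasure := by
    rw [← integral_sub hVi hit]
    exact integral_congr_ae (ae_of_all _ fun s => by simp)
  rw [(V k).integral_add_drift, hAi] at hct
  have h3 := hb t ht
  have h4 : |κ * ∫ s in Set.Iic t, ((V k).process s ω - A s ω) ∂timeMeasure| < c / 2 := by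
    rw [abs_mul]
    exact (mul_le_mul_of_nonneg_left h3 (abs_nonneg κ)).trans_lt hκe
  have h5 := abs_add_le ((V k).integral B t ω - M t ω)
    (κ * ∫ s in Set.Iic t, ((V k).process s ω - A s ω) ∂timeMeasure)
  have h6 : (V k).integral B t ω - M t ω +
      κ * ∫ s in Set.Iic t, ((V k).process s ω - A s ω) ∂timeMeasure =
      (V k).integral B t ω + κ * (∫ s in Set.Iic t, (V k).process s ω ∂timeMeasure) -
      (M t ω + κ * ((∫ s in Set.Iic t, (V k).process s ω ∂timeMeasure) -
        ∫ s in Set.Iic t, ((V k).process s ω - A s ω) ∂timeMeasure)) := by ring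
  rw [h6] at h5
  linarith

/-- Cumulative consumption financed from positive capital is bounded in probability under the
drift-removing measure, uniformly over strategies. -/
lemma driftRemovingMeasure_consumption_le [IsProbabilityMeasure P] (hB : IsBrownianFor 𝓕 P B)
    {κ r y X₀ : ℝ} (hr : 0 ≤ r) {A M X c : ℝ≥0 → Ω → ℝ} (hM : IsItoIntegral 𝓕 P B A M)
    (hX : ∀ᵐ ω ∂P, Continuous (fun t => X t ω)) (hXpos : ∀ᵐ ω ∂P, ∀ t, 0 < X t ω)
    (hc : ∀ᵐ ω ∂P, ∀ t, 0 ≤ c t ω)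
    (hci : ∀ᵐ ω ∂P, IntegrableOn (fun t => c t ω) (Set.Iic 1) timeMeasure)
    (heq : ∀ᵐ ω ∂P, ∀ t ≤ 1, X t ω = X₀ +
      (∫ s in Set.Iic t, (r * X s ω + y - c s ω) ∂timeMeasure) +
      (M t ω + κ * ∫ s in Set.Iic t, A s ω ∂timeMeasure))
    {L : ℝ} (hL : |X₀| + |y| + 3 < Real.exp (-r) * L) :
    driftRemovingMeasure κ P B 1 {ω | L ≤ ∫ s in Set.Iic 1, c s ω ∂timeMeasure} ≤
      ENNReal.ofReal ((|X₀| + |y| + 4) / (Real.exp (-r) * L - (|X₀| + |y| + 3))) := by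
  have hprob := isProbabilityMeasure_driftRemovingMeasure hB κ 1
  have hinc := hasBrownianIncrements_driftRemovingMeasure hB κ 1
  set Q := driftRemovingMeasure κ P B 1 with hQ
  -- Budget for the lower barrier: |X₀| + 1/2 bounds the initial capital, |y| + 1 is the grid error,
  -- and 1 is the cost of replacing the gains by an elementary integral. The slack that remains
  -- makes the inequality strict.
  set b : ℝ := |X₀| + |y| + 3 with hb
  have hb0 : 0 < b := by positivity
  have hb4 : |X₀| + |y| + 4 = b + 1 := by rw [hb]; ring
  rw [hb4]
  set a : ℝ := Real.exp (-r) * L - b with ha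
  have ha0 : 0 < a := sub_pos.2 hL
  obtain ⟨V, hV⟩ := hM.exists_approx_add_drift κ
  set G : ℝ≥0 → Ω → ℝ := fun t ω => M t ω + κ * ∫ s in Set.Iic t, A s ω ∂timeMeasure with hG
  set N : ℕ → ℝ≥0 → Ω → ℝ := fun k t ω => (V k).integral (fun t ω => B t ω + κ * t) t ω with hN
  set E : ℕ → Set Ω := fun k => {ω | ∃ t ≤ 1, 1 / 2 ≤ |N k t ω - G t ω|} with hE
  have hEQ : Tendsto (fun k => Q (E k)) atTop (𝓝 0) :=
    tendsto_driftRemovingMeasure hB κ 1 (hV (1 / 2) (by norm_num))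
  set good : Set Ω := {ω | Continuous (fun t => X t ω) ∧ (∀ t, 0 < X t ω) ∧ (∀ t, 0 ≤ c t ω) ∧
    IntegrableOn (fun t => c t ω) (Set.Iic 1) timeMeasure ∧
    ∀ t ≤ 1, X t ω = X₀ + (∫ s in Set.Iic t, (r * X s ω + y - c s ω) ∂timeMeasure) + G t ω}
    with hgood
  have hbad : Q goodᶜ = 0 := by
    refine driftRemovingMeasure_absolutelyContinuous κ 1 ?_
    have : ∀ᵐ ω ∂P, ω ∈ good := by
      filter_upwards [hX, hXpos, hc, hci, heq] with ω h1 h2 h3 h4 h5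
      exact ⟨h1, h2, h3, h4, h5⟩
    exact this
  set S : Set Ω := {ω | L ≤ ∫ s in Set.Iic 1, c s ω ∂timeMeasure} with hS
  have hk : ∀ k, Q S ≤ Q (E k) + ENNReal.ofReal ((b + 1) / a) := by
    intro k
    obtain ⟨K, hK⟩ := measure_stays_above_and_reaches_le hinc (V k) hr
    -- The grid inequality holds from some mesh on that depends on the state; requiring it for all
    -- finer meshes makes these sets increase, so continuity from below applies.
    set U : ℕ → Set Ω := fun n => {ω | ω ∈ good ∧ ω ∉ E k ∧ ω ∈ S ∧ ∀ n' ≥ n, ∀ j ≤ n',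
      -X 0 ω - |y| - 1 + Real.exp (-r) * ∫ s in Set.Iic (grid n' j), c s ω ∂timeMeasure ≤
        discountedSum r n' (fun t => G t ω) j} with hU
    have hUmono : Monotone U := fun n n' hnn' ω hω =>
      ⟨hω.1, hω.2.1, hω.2.2.1, fun l hl => hω.2.2.2 l (hnn'.trans hl)⟩
    have hUle : ∀ n : ℕ, 0 < n → Q (U n) ≤ ENNReal.ofReal ((b + 1 + K / n) / a) := by
      intro n hn
      refine (measure_mono ?_).trans (hK a b n ha0 hb0 hn)
      rintro ω ⟨⟨-, -, h0c, -, h0eq⟩, hωE, hωS, hωn⟩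
      have hclose : ∀ t ≤ 1, |N k t ω - G t ω| ≤ 1 / 2 := by
        intro t ht
        by_contra hcon
        exact hωE ⟨t, ht, (not_le.1 hcon).le⟩
      have hX0 : X 0 ω ≤ |X₀| + 1 / 2 := by
        have h1 := h0eq 0 zero_le
        have h2 : ∫ s in Set.Iic (0 : ℝ≥0), (r * X s ω + y - c s ω) ∂timeMeasure = 0 := by
          apply setIntegral_measure_zero
          rw [timeMeasure_Iic]; rfl
        have h3 := hclose 0 zero_le
        have h4 : N k 0 ω = 0 := (V k).integral_zero _ ω
        rw [h4, zero_sub, abs_neg] at h3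
        have h5 := le_abs_self X₀
        have h6 := le_abs_self (G 0 ω)
        rw [h1, h2]
        linarith
      have hdiff : ∀ j ≤ n, -1 + discountedSum r n (fun t => G t ω) j ≤
          discountedSum r n (fun t => N k t ω) j := by
        intro j hj
        have h1 := abs_discountedSum_le hr hn hclose hj
        rw [discountedSum_sub] at h1
        have := (abs_le.1 h1).1
        linarith
      refine ⟨fun l hl => ?_, ?_⟩
      · have h1 := hωn n le_rfl l hl.le
        have h2 := hdiff l hl.le
        have h3 : 0 ≤ Real.exp (-r) * ∫ s in Set.Iic (grid n l), c s ω ∂timeMeasure :=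
          mul_nonneg (Real.exp_pos _).le (setIntegral_nonneg measurableSet_Iic fun s _ => h0c s)
        refine lt_of_lt_of_le ?_ h2
        linarith
      · have h1 := hωn n le_rfl n le_rfl
        have h2 := hdiff n le_rfl
        rw [grid_self hn] at h1
        have h3 : Real.exp (-r) * L ≤ Real.exp (-r) * ∫ s in Set.Iic 1, c s ω ∂timeMeasure :=
          mul_le_mul_of_nonneg_left hωS (Real.exp_pos _).le
        refine le_trans ?_ h2
        linarith
    have hUlim : Tendsto (fun n => Q (U n)) atTop (𝓝 (Q (⋃ n, U n))) :=
      tendsto_measure_iUnion_atTop hUmono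
    have hRlim : Tendsto (fun n : ℕ => ENNReal.ofReal ((b + 1 + K / n) / a)) atTop
        (𝓝 (ENNReal.ofReal ((b + 1) / a))) := by
      refine (ENNReal.continuous_ofReal.tendsto _).comp ?_
      have h1 : Tendsto (fun n : ℕ => K / (n : ℝ)) atTop (𝓝 0) :=
        tendsto_const_div_atTop_nhds_zero_nat K
      have h2 := (h1.const_add (b + 1)).div_const a
      rwa [add_zero] at h2
    have hUnion : Q (⋃ n, U n) ≤ ENNReal.ofReal ((b + 1) / a) := by
      refine le_of_tendsto_of_tendsto hUlim hRlim ?_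
      filter_upwards [eventually_gt_atTop 0] with n hn using hUle n hn
    have hcover : S ⊆ (goodᶜ ∪ E k) ∪ ⋃ n, U n := by
      intro ω hω
      by_cases h1 : ω ∈ good
      · by_cases h2 : ω ∈ E k
        · exact Or.inl (Or.inr h2)
        · right
          obtain ⟨n, hn⟩ := eventually_atTop.1
            (eventually_le_discountedSum hr h1.1 h1.2.1 h1.2.2.1 h1.2.2.2.1 h1.2.2.2.2)
          exact Set.mem_iUnion.2 ⟨n, h1, h2, hω, hn⟩
      · exact Or.inl (Or.inl h1)
    calc Q S ≤ Q ((goodᶜ ∪ E k) ∪ ⋃ n, U n) := measure_mono hcover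
      _ ≤ (Q goodᶜ + Q (E k)) + Q (⋃ n, U n) :=
          (measure_union_le _ _).trans (add_le_add (measure_union_le _ _) le_rfl)
      _ ≤ _ := by
          rw [hbad, zero_add]
          gcongr
  -- The constant K depends on the approximating integrand, so the mesh was refined first, with k
  -- fixed; only now does k tend to infinity.
  have hlim := hEQ.add_const (ENNReal.ofReal ((b + 1) / a))
  rw [zero_add] at hlim
  exact ge_of_tendsto' hlim hk

end Budget

/-! ### A positive lower bound for the loss of every plan -/

section LowerBound

variable {Ω : Type*} {mΩ : MeasurableSpace Ω} {𝓕 : Filtration ℝ≥0 mΩ} {P : Measure Ω}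
  {B : ℝ≥0 → Ω → ℝ} {m : Model}

/-- The level L depends only on initial capital and market data, not on the plan; this is what makes
the lower bound uniform. -/
lemma exists_consumption_level [IsProbabilityMeasure P] (hB : IsBrownianFor 𝓕 P B)
    (κ r y X₀ : ℝ) : ∃ L : ℝ, 0 < L ∧ |X₀| + |y| + 3 < Real.exp (-r) * L ∧
      ∀ s, driftRemovingMeasure κ P B 1 s ≤ ENNReal.ofReal
        ((|X₀| + |y| + 4) / (Real.exp (-r) * L - (|X₀| + |y| + 3))) → P s < 1 / 2 := by
  obtain ⟨d, hd, h⟩ := exists_le_of_driftRemovingMeasure_lt hB κ 1 (e := 1 / 2) (by simp)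
  have h1 : Tendsto (fun L : ℝ => Real.exp (-r) * L) atTop atTop :=
    tendsto_id.const_mul_atTop (Real.exp_pos _)
  have h2 : Tendsto (fun L : ℝ => Real.exp (-r) * L - (|X₀| + |y| + 3)) atTop atTop :=
    tendsto_atTop_add_const_right _ _ h1
  have h3 : Tendsto (fun L : ℝ => ENNReal.ofReal
      ((|X₀| + |y| + 4) / (Real.exp (-r) * L - (|X₀| + |y| + 3)))) atTop (𝓝 0) := by
    have := (ENNReal.continuous_ofReal.tendsto _).comp (h2.const_div_atTop (|X₀| + |y| + 4))
    rwa [ENNReal.ofReal_zero] at this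
  obtain ⟨L, hL1, hL2, hL3⟩ := ((eventually_gt_atTop 0).and
    ((h1.eventually_gt_atTop _).and (h3.eventually_lt_const hd))).exists
  exact ⟨L, hL1, hL2, fun s hs => h s (hs.trans_lt hL3)⟩

open Classical in
/-- Total spending on goods, including the loan payment after the retrofit. -/
noncomputable def spending (m : Model) (τ : Ω → WithTop ℝ≥0) (u : Controls Ω) (t : ℝ≥0) (ω : Ω) :
    ℝ :=
  u.x t ω + (if (t : WithTop ℝ≥0) < τ ω then u.s t ω / m.η * m.price
    else u.s t ω / m.ηR * m.price + m.ρ * m.K)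

lemma ηR_pos (m : Model) : 0 < m.ηR := m.η_pos.trans m.η_lt

/-- A unit of energy service is cheapest at the efficiency after the retrofit, and the loan payment
is nonnegative, so one bound serves both regimes. -/
lemma le_spending {τ : Ω → WithTop ℝ≥0} {u : Controls Ω} {t : ℝ≥0} {ω : Ω}
    (hs : 0 ≤ u.s t ω) : u.x t ω + u.s t ω / m.ηR * m.price ≤ spending m τ u t ω := by
  have h1 := m.η_pos
  have h2 := ηR_pos m
  have h3 := m.price_pos
  have h4 := m.K_pos
  have h5 := m.μR_pos
  have h6 := m.μR_le
  unfold spending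
  split_ifs
  · have : u.s t ω / m.ηR ≤ u.s t ω / m.η := div_le_div_of_nonneg_left hs h1 m.η_lt.le
    gcongr
  · have : 0 ≤ m.ρ * m.K := mul_nonneg (by linarith) h4.le
    linarith

lemma measurable_spending {τ : Ω → WithTop ℝ≥0} {u : Controls Ω} (hτ : IsStoppingTime 𝓕 τ)
    (hx : IsStronglyProgressive 𝓕 u.x) (hs : IsStronglyProgressive 𝓕 u.s) (ω : Ω) :
    Measurable (fun t => spending m τ u t ω) := by
  have h1 := measurable_section_of_prog hx ω
  have h2 := measurable_section_of_prog hs ω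
  have h3 : MeasurableSet {t : ℝ≥0 | (t : WithTop ℝ≥0) < τ ω} :=
    (measurableSet_lt_stopping hτ).preimage (measurable_id.prodMk measurable_const)
  exact h1.add (Measurable.ite h3 ((h2.div_const _).mul_const _)
    (((h2.div_const _).mul_const _).add_const _))

/-- Bounded spending bounds discounted disutility from below. -/
lemma le_lintegral_disutility {τ : Ω → WithTop ℝ≥0} {u : Controls Ω} {ω : Ω}
    (hx : ∀ t, 0 ≤ u.x t ω) (hs : ∀ t, 0 ≤ u.s t ω)
    (hmeas : Measurable (fun t => spending m τ u t ω))
    (hint : IntegrableOn (fun t => spending m τ u t ω) (Set.Iic 1) timeMeasure) {L : ℝ}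
    (hL : 0 < L) (hlt : ∫ t in Set.Iic 1, spending m τ u t ω ∂timeMeasure < L) :
    ENNReal.ofReal (Real.exp (-m.δHat)) *
      ENNReal.ofReal (m.excessDisutility (2 * L) (2 * L * m.ηR / m.price)) * (1 / 2) ≤
    ∫⁻ t, ENNReal.ofReal (Real.exp (-m.δHat * t)) *
      m.disutility (u.x t ω) (u.s t ω) ∂timeMeasure := by
  have h2 := ηR_pos m
  have h3 := m.price_pos
  have hδ := m.δHat_pos
  have hnn : ∀ t, 0 ≤ spending m τ u t ω := fun t => by
    refine le_trans ?_ (le_spending (hs t))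
    have := hx t
    have := hs t
    positivity
  -- By Markov's inequality spending stays below 2L for at least half of the unit interval, and
  -- there both consumption rates are bounded.
  set S : Set ℝ≥0 := {t | spending m τ u t ω < 2 * L} with hS
  have hSm : MeasurableSet S := measurableSet_lt hmeas measurable_const
  have hmarkov : (timeMeasure.restrict (Set.Iic 1)) Sᶜ ≤ 1 / 2 := by
    have h := mul_meas_ge_le_integral_of_nonneg (ae_of_all _ hnn) hint (2 * L)
    have hset : {t | 2 * L ≤ spending m τ u t ω} = Sᶜ := by ext t; simp [hS]
    rw [hset] at h
    have h5 : (timeMeasure.restrict (Set.Iic 1)).real Sᶜ ≤ 1 / 2 := by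
      by_contra hcon
      have : 2 * L * (1 / 2) < 2 * L * (timeMeasure.restrict (Set.Iic 1)).real Sᶜ :=
        mul_lt_mul_of_pos_left (not_le.1 hcon) (by positivity)
      linarith
    rw [← ofReal_measureReal]
    refine (ENNReal.ofReal_le_ofReal h5).trans ?_
    rw [ENNReal.ofReal_div_of_pos two_pos]
    simp
  have hhalf : 1 / 2 ≤ timeMeasure (S ∩ Set.Iic 1) := by
    have h5 : timeMeasure (S ∩ Set.Iic 1) + (timeMeasure.restrict (Set.Iic 1)) Sᶜ = 1 := by
      rw [← Measure.restrict_apply hSm, measure_add_measure_compl hSm,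
        Measure.restrict_apply_univ, timeMeasure_Iic]
      rfl
    by_contra hcon
    have h6 : timeMeasure (S ∩ Set.Iic 1) + (timeMeasure.restrict (Set.Iic 1)) Sᶜ <
        1 / 2 + 1 / 2 := ENNReal.add_lt_add_of_lt_of_le
      (ne_top_of_le_ne_top (by simp) hmarkov) (not_le.1 hcon) hmarkov
    rw [h5, ENNReal.add_halves] at h6
    exact lt_irrefl _ h6
  calc _ ≤ ENNReal.ofReal (Real.exp (-m.δHat)) *
        ENNReal.ofReal (m.excessDisutility (2 * L) (2 * L * m.ηR / m.price)) *
          timeMeasure (S ∩ Set.Iic 1) := by gcongr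
    _ = ∫⁻ _ in S ∩ Set.Iic 1, ENNReal.ofReal (Real.exp (-m.δHat)) *
        ENNReal.ofReal (m.excessDisutility (2 * L) (2 * L * m.ηR / m.price)) ∂timeMeasure := by
          rw [setLIntegral_const]
    _ ≤ ∫⁻ t in S ∩ Set.Iic 1, ENNReal.ofReal (Real.exp (-m.δHat * t)) *
        m.disutility (u.x t ω) (u.s t ω) ∂timeMeasure := by
          refine setLIntegral_mono' (hSm.inter measurableSet_Iic) fun t ht => ?_
          have ht1 : (t : ℝ) ≤ 1 := by exact_mod_cast ht.2
          have hsp : spending m τ u t ω < 2 * L := ht.1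
          have hle := (le_spending (m := m) (τ := τ) (u := u) (hs t)).trans hsp.le
          have hx' := hx t
          have hs' := hs t
          have hps : 0 ≤ u.s t ω / m.ηR * m.price := by positivity
          have hxs := m.xSub_pos
          have hss := m.sSub_pos
          refine mul_le_mul' (ENNReal.ofReal_le_ofReal (Real.exp_le_exp.2 ?_))
            (Model.le_disutility (by linarith) ?_)
          · nlinarith
          · have h7 : u.s t ω ≤ 2 * L * m.ηR / m.price := by
              rw [le_div_iff₀ h3]
              have h8 : u.s t ω / m.ηR * m.price ≤ 2 * L := by linarith
              have h9 : u.s t ω / m.ηR * m.price = u.s t ω * m.price / m.ηR := by ring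
              rw [h9] at h8
              exact (div_le_iff₀ h2).1 h8
            linarith
    _ ≤ _ := setLIntegral_le_lintegral _ _

/-- Bounds below the disutility of all plans from a given initial wealth. -/
lemma lossF_pos [IsProbabilityMeasure P] (hB : IsBrownianFor 𝓕 P B) (w : ℝ) :
    0 < lossF 𝓕 P B m w := by
  have h2 := ηR_pos m
  have h3 := m.price_pos
  -- The larger human capital keeps W + h positive in both regimes, so the switch at τ needs no
  -- separate treatment.
  set h := max m.H m.HR with hh
  -- The market price of risk: with it, the excess return is exactly κ times the diffusion
  -- coefficient and moves from the drift into the gains.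
  set κ := (m.μS - m.μR) / m.σS with hκ
  set y := m.Y - m.μR * h with hy
  obtain ⟨L, hL0, hL, hLP⟩ := exists_consumption_level hB κ m.μR y (w + h)
  set q : ℝ≥0∞ := ENNReal.ofReal (Real.exp (-m.δHat)) *
    ENNReal.ofReal (m.excessDisutility (2 * L) (2 * L * m.ηR / m.price)) * (1 / 2) with hq
  have hexc : 0 < m.excessDisutility (2 * L) (2 * L * m.ηR / m.price) :=
    Model.excessDisutility_pos (by positivity) (by positivity)
  have hq0 : 0 < q := by
    rw [hq]
    refine ENNReal.mul_pos (mul_ne_zero ?_ ?_) (by simp)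
    · rw [ne_eq, ENNReal.ofReal_eq_zero, not_le]; positivity
    · rw [ne_eq, ENNReal.ofReal_eq_zero, not_le]; exact hexc
  have hbound : q * (1 / 2) ≤ lossF 𝓕 P B m w := by
    refine le_iInf fun τ => le_iInf fun u => le_iInf fun W => le_iInf fun hadm => ?_
    obtain ⟨M, hM, hMeq⟩ := hadm.wealth.eqn
    have hAint := hM.ae_integrableOn
    have hspm := measurable_spending (m := m) hadm.stopping hadm.x_prog hadm.s_prog
    have hdrift : ∀ t ω, wealthDrift m τ u W t ω =
        m.μR * W t ω + κ * (u.a t ω * m.σS * W t ω) + m.Y - spending m τ u t ω := by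
      intro t ω
      have hσ := m.σS_pos.ne'
      have e : κ * (u.a t ω * m.σS * W t ω) = u.a t ω * (m.μS - m.μR) * W t ω := by
        rw [hκ]; field_simp
      rw [e, wealthDrift, spending]
      ring
    have hspint : ∀ᵐ ω ∂P,
        IntegrableOn (fun t => spending m τ u t ω) (Set.Iic 1) timeMeasure := by
      filter_upwards [hAint, hadm.wealth.drift_integrable, hadm.wealth.cont] with ω h4 h5 h6
      have h7 := ((((continuous_integrableOn_Iic h6 1).const_mul m.μR).add
        (h4.const_mul κ)).add (integrable_const m.Y)).sub (h5 1)
      refine h7.congr (ae_of_all _ fun t => ?_)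
      simp only [Pi.add_apply, Pi.sub_apply, hdrift]
      ring
    have hQ := driftRemovingMeasure_consumption_le hB (κ := κ) (r := m.μR) (y := y)
      (X₀ := w + h) m.μR_pos.le (X := fun t ω => W t ω + h) (c := spending m τ u) hM
      (by filter_upwards [hadm.wealth.cont] with ω hω using hω.add_const h)
      (by
        filter_upwards [hadm.capital_pos] with ω hω t
        have h4 := hω t
        have h5 := le_max_left m.H m.HR
        have h6 := le_max_right m.H m.HR
        split_ifs at h4 <;> linarith)
      (ae_of_all _ fun ω t => by
        refine le_trans ?_ (le_spending (hadm.s_nonneg t ω))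
        have := hadm.x_nonneg t ω
        have := hadm.s_nonneg t ω
        positivity)
      hspint
      (by
        filter_upwards [hMeq, hAint, hspint, hadm.wealth.cont] with ω h4 h5 h6 h7 t ht
        have hsub : Set.Iic t ⊆ Set.Iic (1 : ℝ≥0) := Set.Iic_subset_Iic.2 ht
        have e : ∫ s in Set.Iic t, wealthDrift m τ u W s ω ∂timeMeasure =
            (∫ s in Set.Iic t, (m.μR * (W s ω + h) + y - spending m τ u s ω) ∂timeMeasure) +
            κ * ∫ s in Set.Iic t, u.a s ω * m.σS * W s ω ∂timeMeasure := by
          rw [← integral_const_mul, ← integral_add]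
          · refine integral_congr_ae (ae_of_all _ fun s => ?_)
            simp only [hdrift, hy]
            ring
          · exact (((continuous_integrableOn_Iic (h7.add_const h) t).const_mul m.μR).add
              (integrable_const y)).sub (h6.mono_set hsub)
          · exact (h5.mono_set hsub).const_mul κ
        rw [h4 t, e]
        ring)
      hL
    set D : Set Ω := {ω | L ≤ ∫ s in Set.Iic 1, spending m τ u s ω ∂timeMeasure} with hD
    have hPD : P D < 1 / 2 := hLP D hQ
    -- A measurable hull has the same mass as D and makes the complement rule available without
    -- proving D measurable.
    set D' := toMeasurable P D with hD'
    have hD'm : MeasurableSet D' := measurableSet_toMeasurable P D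
    have hPD' : P D' < 1 / 2 := by rwa [hD', measure_toMeasurable]
    have hcompl : 1 / 2 ≤ P D'ᶜ := by
      have h4 : P D' + P D'ᶜ = 1 := by rw [measure_add_measure_compl hD'm, measure_univ]
      by_contra hcon
      have h5 : P D' + P D'ᶜ < 1 / 2 + 1 / 2 := ENNReal.add_lt_add hPD' (not_le.1 hcon)
      rw [h4, ENNReal.add_halves] at h5
      exact lt_irrefl _ h5
    calc q * (1 / 2) ≤ q * P D'ᶜ := by gcongr
      _ = ∫⁻ _ in D'ᶜ, q ∂P := by rw [setLIntegral_const]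
      _ ≤ ∫⁻ ω in D'ᶜ, ∫⁻ t, ENNReal.ofReal (Real.exp (-m.δHat * t)) *
          m.disutility (u.x t ω) (u.s t ω) ∂timeMeasure ∂P := by
            refine lintegral_mono_ae ?_
            filter_upwards [ae_restrict_mem hD'm.compl, ae_restrict_of_ae hspint] with ω h4 h5
            have h6 : ω ∉ D := fun h7 => h4 (subset_toMeasurable P D h7)
            exact le_lintegral_disutility (fun t => hadm.x_nonneg t ω)
              (fun t => hadm.s_nonneg t ω) (hspm ω) h5 hL0 (not_le.1 h6)
      _ ≤ _ := setLIntegral_le_lintegral _ _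
  refine lt_of_lt_of_le ?_ hbound
  exact ENNReal.mul_pos hq0.ne' (by simp)

end LowerBound

/-! ### Finiteness through a risk-free plan -/

section ConstantPlan

variable {Ω : Type*} {mΩ : MeasurableSpace Ω} {𝓕 : Filtration ℝ≥0 mΩ} {P : Measure Ω}
  {B : ℝ≥0 → Ω → ℝ} {m : Model}

/-- Hold only the risk-free asset and spend the interest on disposable capital. -/
noncomputable def constantControls (Ω : Type*) (m : Model) (w : ℝ) : Controls Ω where
  a _ _ := 0
  x _ _ := m.xSub + m.μR * (w + m.H) / 2
  s _ _ := m.sSub + m.μR * (w + m.H) / 2 * m.η / m.price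

lemma isItoIntegral_zero : IsItoIntegral 𝓕 P B (fun _ _ => 0) (fun _ _ => 0) where
  integrand_prog := isStronglyProgressive_const 𝓕 0
  cont := ae_of_all _ fun _ => continuous_const
  approx := by
    refine ⟨fun _ => ⟨0, fun _ => 0, fun _ _ => 0, monotone_const, fun _ => stronglyMeasurable_const,
      fun _ => ⟨0, fun _ => by simp⟩⟩, fun T => ⟨fun c hc => ?_, fun c hc => ?_⟩⟩
    · simp [SimpleIntegrand.process, hc.ne']
    · simp [SimpleIntegrand.integral, hc.not_ge]

/-- Half of the interest on disposable capital buys each good above subsistence, so income and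
spending balance and wealth never moves. -/
lemma isAdmissible_constant {w : ℝ} (hw : -m.H < w) :
    IsAdmissible 𝓕 P B m w never (constantControls Ω m w) (fun _ _ => w) := by
  have h1 := m.η_pos
  have h3 := m.price_pos
  have h4 := m.μR_pos
  have h5 := m.xSub_pos
  have h6 := m.sSub_pos
  have h7 : 0 < w + m.H := by linarith
  have hdrift : ∀ t ω,
      wealthDrift m never (constantControls Ω m w) (fun _ _ => w) t ω = 0 := by
    intro t ω
    rw [wealthDrift_never]
    have e := m.μR_mul_H
    have e2 : (m.sSub + m.μR * (w + m.H) / 2 * m.η / m.price) / m.η * m.price =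
        m.sSub / m.η * m.price + m.μR * (w + m.H) / 2 := by
      field_simp
    simp only [constantControls]
    rw [e2]
    linarith
  refine ⟨fun t => ?_, isStronglyProgressive_const 𝓕 _,
    isStronglyProgressive_const 𝓕 _, isStronglyProgressive_const 𝓕 _, fun _ _ => ?_,
    fun _ _ => ?_, ⟨isStronglyProgressive_const 𝓕 w, ae_of_all _ fun _ => continuous_const, ?_,
    fun _ _ => 0, ?_, ?_⟩, ?_⟩
  · simp [never]
  · simp only [constantControls]; positivity
  · simp only [constantControls]; positivity
  · refine ae_of_all _ fun ω t => ?_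
    simp only [hdrift]
    exact integrable_zero _ _ _
  · have : (fun (t : ℝ≥0) (ω : Ω) => (constantControls Ω m w).a t ω * m.σS * w) =
        fun _ _ => 0 := by
      funext t ω
      simp [constantControls]
    rw [this]
    exact isItoIntegral_zero
  · refine ae_of_all _ fun ω t => ?_
    simp only [hdrift]
    simp
  · refine ae_of_all _ fun ω t => ?_
    rw [if_pos (show (t : WithTop ℝ≥0) < never ω from WithTop.coe_lt_top t)]
    exact h7

lemma lintegral_exp_decay_lt_top {d : ℝ} (hd : 0 < d) :
    ∫⁻ t : ℝ≥0, ENNReal.ofReal (Real.exp (-d * t)) ∂timeMeasure < ∞ := by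
  have h := lintegral_map (μ := timeMeasure) (f := fun t : ℝ => ENNReal.ofReal (Real.exp (-d * t)))
    (by fun_prop) measurableEmbedding_nnreal_coe.measurable
  rw [← h, map_timeMeasure]
  have hint : IntegrableOn (fun t : ℝ => Real.exp (-d * t)) (Set.Ici 0) := by
    rw [integrableOn_Ici_iff_integrableOn_Ioi]
    exact exp_neg_integrableOn_Ioi 0 hd
  exact hint.lintegral_lt_top

lemma lossFHat_lt_top [IsProbabilityMeasure P] {w : ℝ} (hw : -m.H < w) :
    lossFHat 𝓕 P B m w < ∞ := by
  refine (lossFHat_le (isAdmissible_constant hw)).trans_lt ?_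
  have h1 := m.η_pos
  have h3 := m.price_pos
  have h4 := m.μR_pos
  have h7 : 0 < w + m.H := by linarith
  have hx : m.xSub < m.xSub + m.μR * (w + m.H) / 2 := by
    have : 0 < m.μR * (w + m.H) / 2 := by positivity
    linarith
  have hs : m.sSub < m.sSub + m.μR * (w + m.H) / 2 * m.η / m.price := by
    have : 0 < m.μR * (w + m.H) / 2 * m.η / m.price := by positivity
    linarith
  simp only [expectedDisutility, constantControls, Model.disutility_of_lt hx hs]
  rw [lintegral_const, measure_univ, mul_one, lintegral_mul_const' _ _ ENNReal.ofReal_ne_top]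
  exact ENNReal.mul_lt_top (lintegral_exp_decay_lt_top m.δHat_pos) ENNReal.ofReal_lt_top

end ConstantPlan

/-! ### Inverting the counterfactual value function -/

section EquivalentVariation

variable {Ω : Type*} {mΩ : MeasurableSpace Ω} {𝓕 : Filtration ℝ≥0 mΩ} {P : Measure Ω}
  {B : ℝ≥0 → Ω → ℝ} {m : Model}

/-- The counterfactual loss is a power of disposable capital. -/
lemma lossFHat_eq [IsProbabilityMeasure P] {w w' : ℝ} (hw : -m.H < w) (hw' : -m.H < w') :
    lossFHat 𝓕 P B m w' =
      ENNReal.ofReal (((w' + m.H) / (w + m.H)) ^ (1 - m.γ)) * lossFHat 𝓕 P B m w := by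
  have h1 : 0 < w + m.H := by linarith
  have h2 : 0 < w' + m.H := by linarith
  refine le_antisymm (lossFHat_le_homogeneous hw hw') ?_
  -- The reverse inequality is the same bound with w and w' exchanged, since the two factors
  -- multiply to one.
  calc _ ≤ ENNReal.ofReal (((w' + m.H) / (w + m.H)) ^ (1 - m.γ)) *
        (ENNReal.ofReal (((w + m.H) / (w' + m.H)) ^ (1 - m.γ)) * lossFHat 𝓕 P B m w') := by
        gcongr
        exact lossFHat_le_homogeneous hw' hw
    _ = lossFHat 𝓕 P B m w' := by
        rw [← mul_assoc, ← ENNReal.ofReal_mul (by positivity),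
          ← Real.mul_rpow (by positivity) (by positivity)]
        have : (w' + m.H) / (w + m.H) * ((w + m.H) / (w' + m.H)) = 1 := by field_simp
        rw [this, Real.one_rpow, ENNReal.ofReal_one, one_mul]

lemma lossFHat_pos [IsProbabilityMeasure P] (hB : IsBrownianFor 𝓕 P B) (w : ℝ) :
    0 < lossFHat 𝓕 P B m w :=
  (lossF_pos hB w).trans_le (lossF_le_lossFHat 𝓕 P B m w)

lemma lossFHat_strictAnti [IsProbabilityMeasure P] (hB : IsBrownianFor 𝓕 P B) {w w' : ℝ}
    (hw : -m.H < w) (h : w < w') : lossFHat 𝓕 P B m w' < lossFHat 𝓕 P B m w := by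
  have h1 : 0 < w + m.H := by linarith
  have hγ := m.γ_gt
  rw [lossFHat_eq hw (hw.trans h)]
  have hk : 1 < (w' + m.H) / (w + m.H) := (one_lt_div h1).2 (by linarith)
  have h2 : ENNReal.ofReal (((w' + m.H) / (w + m.H)) ^ (1 - m.γ)) < 1 := by
    rw [ENNReal.ofReal_lt_one]
    exact Real.rpow_lt_one_of_one_lt_of_neg hk (by linarith)
  calc _ < 1 * lossFHat 𝓕 P B m w :=
        ENNReal.mul_lt_mul_left (lossFHat_pos hB w).ne' (lossFHat_lt_top hw).ne h2
    _ = _ := one_mul _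

lemma lossFHat_injOn [IsProbabilityMeasure P] (hB : IsBrownianFor 𝓕 P B) :
    Set.InjOn (lossFHat 𝓕 P B m) (Set.Ioi (-m.H)) := by
  intro w hw w' hw' h
  rcases lt_trichotomy w w' with h1 | h1 | h1
  · exact absurd h (lossFHat_strictAnti hB hw h1).ne'
  · exact h1
  · exact absurd h (lossFHat_strictAnti hB hw' h1).ne

lemma exists_lossFHat_eq_lossF [IsProbabilityMeasure P] (hB : IsBrownianFor 𝓕 P B) {w : ℝ}
    (hw : -m.H < w) :
    ∃ w', w ≤ w' ∧ lossFHat 𝓕 P B m w' = lossF 𝓕 P B m w := by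
  have h1 : 0 < w + m.H := by linarith
  have hγ := m.γ_gt
  have hle := lossF_le_lossFHat 𝓕 P B m w
  have htop := lossFHat_lt_top (𝓕 := 𝓕) (P := P) (B := B) hw
  have hpos := lossF_pos (m := m) hB w
  have hposHat := lossFHat_pos (m := m) hB w
  set q := (lossF 𝓕 P B m w).toReal / (lossFHat 𝓕 P B m w).toReal with hq
  have hF : 0 < (lossF 𝓕 P B m w).toReal := ENNReal.toReal_pos hpos.ne' (hle.trans_lt htop).ne
  have hFHat : 0 < (lossFHat 𝓕 P B m w).toReal := ENNReal.toReal_pos hposHat.ne' htop.ne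
  have hq0 : 0 < q := div_pos hF hFHat
  have hq1 : q ≤ 1 := (div_le_one hFHat).2 (ENNReal.toReal_mono htop.ne hle)
  -- Solves k^(1-γ) = q. As q ≤ 1 and the exponent is negative, k ≥ 1; this is where nonnegativity
  -- of the equivalent variation arises.
  set k := q ^ (1 / (1 - m.γ)) with hk
  have hk1 : 1 ≤ k := Real.one_le_rpow_of_pos_of_le_one_of_nonpos hq0 hq1
    (one_div_nonpos.2 (by linarith))
  refine ⟨k * (w + m.H) - m.H, by nlinarith, ?_⟩
  rw [lossFHat_eq hw (by nlinarith)]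
  have e : (k * (w + m.H) - m.H + m.H) / (w + m.H) = k := by field_simp; ring
  rw [e, hk, ← Real.rpow_mul hq0.le, one_div_mul_cancel (by linarith), Real.rpow_one, hq,
    ENNReal.ofReal_div_of_pos hFHat, ENNReal.ofReal_toReal htop.ne,
    ENNReal.ofReal_toReal (hle.trans_lt htop).ne, ENNReal.div_mul_cancel hposHat.ne' htop.ne]

lemma neg_coe_ennreal_injective {a b : ℝ≥0∞} (h : -(a : EReal) = -(b : EReal)) : a = b :=
  EReal.coe_ennreal_injective (neg_injective h)

lemma existsUnique_valueFHat_eq [IsProbabilityMeasure P] (hB : IsBrownianFor 𝓕 P B) {w : ℝ}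
    (hw : -m.H < w) :
    ∃! w' : ℝ, w' ∈ Set.Ioi (-m.H) ∧ valueFHat 𝓕 P B m w' = valueF 𝓕 P B m w := by
  obtain ⟨w', hww', h⟩ := exists_lossFHat_eq_lossF (𝓕 := 𝓕) (P := P) hB hw
  refine ⟨w', ⟨hw.trans_le hww', by rw [valueFHat_eq, valueF_eq, h]⟩, ?_⟩
  rintro v ⟨hv, hveq⟩
  rw [valueFHat_eq, valueF_eq] at hveq
  exact lossFHat_injOn hB hv (hw.trans_le hww') ((neg_coe_ennreal_injective hveq).trans h.symm)

lemma equivalentVariation_nonneg [IsProbabilityMeasure P] (hB : IsBrownianFor 𝓕 P B) {w : ℝ}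
    (hw : -m.H < w) : 0 ≤ equivalentVariation 𝓕 P B m w := by
  obtain ⟨w', hww', h⟩ := exists_lossFHat_eq_lossF (𝓕 := 𝓕) (P := P) hB hw
  have hw' : -m.H < w' := hw.trans_le hww'
  have hval : valueFHat 𝓕 P B m w' = valueF 𝓕 P B m w := by rw [valueFHat_eq, valueF_eq, h]
  have hex : ∃ a ∈ Set.Ioi (-m.H), valueFHat 𝓕 P B m a = valueF 𝓕 P B m w := ⟨w', hw', hval⟩
  have h1 : expenditure 𝓕 P B m (valueF 𝓕 P B m w) ∈ Set.Ioi (-m.H) :=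
    Function.invFunOn_mem hex
  have h2 : valueFHat 𝓕 P B m (expenditure 𝓕 P B m (valueF 𝓕 P B m w)) = valueF 𝓕 P B m w :=
    Function.invFunOn_eq hex
  have h3 := (existsUnique_valueFHat_eq hB hw).unique ⟨h1, h2⟩ ⟨hw', hval⟩
  rw [equivalentVariation, h3]
  linarith

end EquivalentVariation

end Retrofit

theorem mainTheorem8 {Ω : Type*} {mΩ : MeasurableSpace Ω} (P : Measure Ω) [IsProbabilityMeasure P]
    (𝓕 : Filtration ℝ≥0 mΩ) (B Bϖ : ℝ≥0 → Ω → ℝ)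
    (hB : Retrofit.IsBrownianFor 𝓕 P B) (hBϖ : IsBrownianReal Bϖ P)
    (m : Retrofit.Model) (w p : ℝ) (hw : -m.H < w) (hp : 0 < p) :
    -- the equivalent variation is well defined and nonnegative
    (∃! w' : ℝ, w' ∈ Set.Ioi (-m.H) ∧
      Retrofit.valueFHat 𝓕 P B m w' = Retrofit.valueF 𝓕 P B m w) ∧
    0 ≤ Retrofit.equivalentVariation 𝓕 P B m w ∧
    -- in the absence of backfire, social cost is nonpositive and total welfare improves
    ∀ (τ : Ω → WithTop ℝ≥0) (u uHat : Retrofit.Controls Ω) (W WHat : ℝ≥0 → Ω → ℝ),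
      Retrofit.IsOptimal 𝓕 P B m w τ u W →
      Retrofit.IsOptimalHat 𝓕 P B m w uHat WHat →
      IndepFun (fun ω t => Retrofit.marginalSocialCost m p Bϖ t ω)
        (fun ω t => (W t ω, WHat t ω)) P →
      (∀ t : ℝ≥0, ∀ᵐ ω ∂P, Retrofit.backfire m τ u.s uHat.s t ω ≤ 0) →
      Retrofit.socialCost P m p Bϖ τ u.s uHat.s ≤ 0 ∧
      0 ≤ Retrofit.totalWelfare 𝓕 P B m w p Bϖ τ u.s uHat.s := by
  have hev := Retrofit.equivalentVariation_nonneg (m := m) hB hw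
  refine ⟨Retrofit.existsUnique_valueFHat_eq hB hw, hev, ?_⟩
  intro τ u uHat W WHat hopt hoptHat _ hQ
  have hmeas := Retrofit.measurable_backfire (m := m) hopt.1.stopping hopt.1.s_prog hoptHat.1.s_prog
  have hzero := Retrofit.socialCost_pos_part_eq_zero hp (Bϖ := Bϖ)
    (Retrofit.ae_ae_nonpos hmeas hQ)
  have hsc : Retrofit.socialCost P m p Bϖ τ u.s uHat.s ≤ 0 := by
    rw [Retrofit.socialCost, hzero, EReal.coe_ennreal_zero, zero_sub]
    exact EReal.neg_le_zero.2 (EReal.coe_ennreal_nonneg _)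
  refine ⟨hsc, ?_⟩
  rw [Retrofit.totalWelfare, sub_eq_add_neg]
  -- The equivalent variation is a real number, so the sum is unambiguous even when the social cost
  -- is `⊥`.
  refine add_nonneg (by exact_mod_cast hev) ?_
  exact EReal.le_neg_of_le_neg (by simpa using hsc)
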